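/- Let $g,k,\mu,\lambda>0$, and let $\rho_0\in C^1(\mathbf R)$ satisfy $\rho_0(x)\to\rho_\pm\in(0,+\infty)$ as $x\to\pm\infty$ and $0<\rho_0'(x)<\rho_m<+\infty$ for all $x\in\mathbf R$. All functions are real-valued; elements of Sobolev spaces are identified when equal almost everywhere. Consider the equation $$\lambda^2\big(k^2\rho_0\phi-(\rho_0\phi')'\big)+\lambda\mu\big(\phi^{(4)}-2k^2\phi''+k^4\phi\big)=gk^2\rho_0'\phi,\qquad(1)$$ and the first-order system for $U=(\phi,\phi',\phi'',\phi''')^T$ associated with it, $U'=(L(x)+\rho_0'(x)R)\,U$ (2), where $$L=\begin{pmatrix}0&1&0&0\\0&0&1&0\\0&0&0&1\\-\frac{\lambda k^2\rho_0}{\mu}-k^4&0&\frac{\lambda\rho_0}{\mu}+2k^2&0\end{pmatrix},\qquad R=\begin{pmatrix}0&0&0&0\\0&0&0&0\\0&0&0&0\\\frac{gk^2}{\lambda\mu}&\frac{\lambda}{\mu}&0&0\end{pmatrix}.$$ Put $\sigma_0(x)=\sqrt{k^2+\lambda\rho_0(x)/\mu}$ and $\sigma_\pm=\sqrt{k^2+\lambda\rho_\pm/\mu}$.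 There exist $\bar x_-<\bar x_+$, bounded solutions $U_1^+,U_2^+$ of (2) on $(\bar x_+,+\infty)$ such that, as $x\to+\infty$, $$e^{kx}U_1^+(x)\to(-k^{-3},k^{-2},-k^{-1},1)^T,\qquad e^{\int_{\bar x_+}^x\sigma_0(y)\,dy}\,U_2^+(x)\to(-\sigma_+^{-3},\sigma_+^{-2},-\sigma_+^{-1},1)^T,$$ and bounded solutions $U_3^-,U_4^-$ of (2) on $(-\infty,\bar x_-)$ such that, as $x\to-\infty$, $$e^{-kx}U_3^-(x)\to(k^{-3},k^{-2},k^{-1},1)^T,\qquad e^{-\int_{\bar x_-}^x\sigma_0(y)\,dy}\,U_4^-(x)\to(\sigma_-^{-3},\sigma_-^{-2},\sigma_-^{-1},1)^T.$$ For every such choice of $\bar x_\pm,U_1^+,U_2^+,U_3^-,U_4^-$ there are $x_-^0\le\bar x_-$, $x_+^0\ge\bar x_+$ and real coefficients $n_{ij}^-(x_-)$ for $x_-\le x_-^0$ and $n_{ij}^+(x_+)$ for $x_+\ge x_+^0$ $(i,j=1,2)$ such that, for all $x_-\le x_-^0$ and $x_+\ge x_+^0$, the following holds. (a) A vector $w\in\mathbf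 R^4$ satisfies $n_{11}^+w_1+n_{12}^+w_2+w_3=0$ and $n_{21}^+w_1+n_{22}^+w_2+w_4=0$, with $n_{ij}^+=n_{ij}^+(x_+)$, if and only if $w\in\operatorname{span}(U_1^+(x_+),U_2^+(x_+))$; and it satisfies the same relations with $n_{ij}^-=n_{ij}^-(x_-)$ if and only if $w\in\operatorname{span}(U_3^-(x_-),U_4^-(x_-))$. (b) If $\Phi\in H^4(\mathbf R)$ satisfies (1) on $\mathbf R$, then $\phi=\Phi|_{(x_-,x_+)}\in H^4((x_-,x_+))$ satisfies (1) on $(x_-,x_+)$ and, at both ends, $$n_{11}^{\pm}\phi(x_\pm)+n_{12}^{\pm}\phi'(x_\pm)+\phi''(x_\pm)=0,\qquad n_{21}^{\pm}\phi(x_\pm)+n_{22}^{\pm}\phi'(x_\pm)+\phi'''(x_\pm)=0.\qquad(3)$$ (c) Conversely, if $\phi\in H^4((x_-,x_+))$ satisfies (1) on $(x_-,x_+)$ and (3) at both ends, then there is exactly one $\Phi\in H^4(\mathbf R)$ that satisfies (1) on $\mathbf R$ and $\Phi=\phi$ on $(x_-,x_+)$. (d) In both cases $\Phi$ is, on $(x_+,+\infty)$,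 the first component of a linear combination of $U_1^+$ and $U_2^+$ and, on $(-\infty,x_-)$, the first component of a linear combination of $U_3^-$ and $U_4^-$. -/

import Mathlib

open Set Filter Topology MeasureTheory
open scoped ContDiff

noncomputable section

namespace RayleighTaylor

/-! ### Sobolev functions on an open subset of the line -/

/-- `ψ` is a weak derivative of order `m` of `φ` on the open set `Ω ⊆ ℝ`. Only the values on `Ω`,
up to null sets, matter. -/
structure IsWeakDeriv (Ω : Set ℝ) (m : ℕ) (φ ψ : ℝ → ℝ) : Prop where
  left_locallyIntegrable : LocallyIntegrableOn φ Ω volume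
  right_locallyIntegrable : LocallyIntegrableOn ψ Ω volume
  integral_eq : ∀ η : ℝ → ℝ, ContDiff ℝ ∞ η → HasCompactSupport η → tsupport η ⊆ Ω →
    ∫ x in Ω, φ x * iteratedDeriv m η x = (-1 : ℝ) ^ m * ∫ x in Ω, ψ x * η x

/-- `φ` represents an element of the real Sobolev space `H^m(Ω) = W^{m,2}(Ω)`: its weak derivatives
of orders `0, …, m` on `Ω` exist and belong to `L²(Ω)`. -/
def MemSobolev (Ω : Set ℝ) (m : ℕ) (φ : ℝ → ℝ) : Prop :=
  ∀ j ≤ m, ∃ ψ : ℝ → ℝ, IsWeakDeriv Ω j φ ψ ∧ MemLp ψ 2 (volume.restrict Ω)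

/-- `t = (φ(x), φ'(x), φ''(x), φ'''(x))`, the values being the traces at `x ∈ closure Ω`, from within
`Ω`, of the weak derivatives of `φ` on `Ω`: the limits at `x` once null sets are discarded.
For an element of `H⁴` of an interval these are the values of its `C³` representative. -/
def HasTraces (Ω : Set ℝ) (φ : ℝ → ℝ) (x : ℝ) (t : Fin 4 → ℝ) : Prop :=
  ∀ j : Fin 4, ∃ ψ : ℝ → ℝ, IsWeakDeriv Ω (j : ℕ) φ ψ ∧
    Tendsto ψ (𝓝[Ω] x ⊓ ae volume) (𝓝 (t j))

/-! ### The density profile and the fourth-order equation -/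

/-- A strictly increasing density profile `ρ₀ ∈ C¹(ℝ)` with positive limits `ρm` at `-∞` and `ρp` at
`+∞`, and with a positive bounded derivative. -/
structure IsIncreasingProfile (ρ₀ : ℝ → ℝ) (ρm ρp : ℝ) : Prop where
  contDiff : ContDiff ℝ 1 ρ₀
  left_pos : 0 < ρm
  right_pos : 0 < ρp
  tendsto_atBot : Tendsto ρ₀ atBot (𝓝 ρm)
  tendsto_atTop : Tendsto ρ₀ atTop (𝓝 ρp)
  deriv_bounds : ∃ M : ℝ, ∀ x, 0 < deriv ρ₀ x ∧ deriv ρ₀ x < M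

/-- `φ ∈ H⁴(Ω)` and
`lam² (k² ρ₀ φ - (ρ₀ φ')') + lam mu (φ'''' - 2 k² φ'' + k⁴ φ) = g k² ρ₀' φ` a.e. on `Ω`, with weak
derivatives on `Ω`; the function `q` is `(ρ₀ φ')'`. -/
def IsH4Solution (g k mu lam : ℝ) (ρ₀ : ℝ → ℝ) (Ω : Set ℝ) (φ : ℝ → ℝ) : Prop :=
  MemSobolev Ω 4 φ ∧
  ∃ φ₁ φ₂ φ₄ q : ℝ → ℝ,
    IsWeakDeriv Ω 1 φ φ₁ ∧ IsWeakDeriv Ω 2 φ φ₂ ∧ IsWeakDeriv Ω 4 φ φ₄ ∧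
    IsWeakDeriv Ω 1 (fun x => ρ₀ x * φ₁ x) q ∧
    ∀ᵐ x ∂(volume.restrict Ω),
      lam ^ 2 * (k ^ 2 * ρ₀ x * φ x - q x) + lam * mu * (φ₄ x - 2 * k ^ 2 * φ₂ x + k ^ 4 * φ x)
        = g * k ^ 2 * deriv ρ₀ x * φ x

/-! ### The first-order system and the decaying solutions at infinity -/

/-- The leading matrix of the first-order system for `(φ, φ', φ'', φ''')`. -/
def matL (k mu lam : ℝ) (ρ₀ : ℝ → ℝ) (x : ℝ) : Matrix (Fin 4) (Fin 4) ℝ :=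
  !![0, 1, 0, 0;
     0, 0, 1, 0;
     0, 0, 0, 1;
     -(lam * k ^ 2 * ρ₀ x / mu) - k ^ 4, 0, lam * ρ₀ x / mu + 2 * k ^ 2, 0]

/-- The matrix multiplying `ρ₀'` in the first-order system. -/
def matR (g k mu lam : ℝ) : Matrix (Fin 4) (Fin 4) ℝ :=
  !![0, 0, 0, 0;
     0, 0, 0, 0;
     0, 0, 0, 0;
     g * k ^ 2 / (lam * mu), lam / mu, 0, 0]

/-- `U' = (L + ρ₀' R) U` on `I`, and `U` is bounded on `I`. -/
def IsBoundedSystemSolution (g k mu lam : ℝ) (ρ₀ : ℝ → ℝ) (I : Set ℝ) (U : ℝ → Fin 4 → ℝ) : Prop :=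
  (∀ x ∈ I, HasDerivAt U
    ((matL k mu lam ρ₀ x + deriv ρ₀ x • matR g k mu lam).mulVec (U x)) x) ∧
  ∃ C : ℝ, ∀ x ∈ I, ‖U x‖ ≤ C

/-- `√(k² + lam r / mu)`; for `r = ρ₀(x)`, `ρ₋`, `ρ₊` this is `σ₀(x)`, `σ₋`, `σ₊`. -/
def sigma (k mu lam r : ℝ) : ℝ := Real.sqrt (k ^ 2 + lam / mu * r)

/-- `U₁, U₂` are bounded solutions of the system on `(xbar, +∞)` with
`e^{kx} U₁ → (-k⁻³, k⁻², -k⁻¹, 1)` and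
`exp(∫_{xbar}^x σ₀) U₂ → (-σ₊⁻³, σ₊⁻², -σ₊⁻¹, 1)` at `+∞`. -/
structure IsDecayingPairAtTop (g k mu lam : ℝ) (ρ₀ : ℝ → ℝ) (ρp xbar : ℝ)
    (U₁ U₂ : ℝ → Fin 4 → ℝ) : Prop where
  solution₁ : IsBoundedSystemSolution g k mu lam ρ₀ (Ioi xbar) U₁
  solution₂ : IsBoundedSystemSolution g k mu lam ρ₀ (Ioi xbar) U₂
  tendsto₁ : Tendsto (fun x => Real.exp (k * x) • U₁ x) atTop
    (𝓝 ![-(k ^ 3)⁻¹, (k ^ 2)⁻¹, -k⁻¹, 1])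
  tendsto₂ : Tendsto
    (fun x => Real.exp (∫ y in xbar..x, sigma k mu lam (ρ₀ y)) • U₂ x) atTop
    (𝓝 ![-(sigma k mu lam ρp ^ 3)⁻¹, (sigma k mu lam ρp ^ 2)⁻¹, -(sigma k mu lam ρp)⁻¹, 1])

/-- `U₃, U₄` are bounded solutions of the system on `(-∞, xbar)` with
`e^{-kx} U₃ → (k⁻³, k⁻², k⁻¹, 1)` and
`exp(-∫_{xbar}^x σ₀) U₄ → (σ₋⁻³, σ₋⁻², σ₋⁻¹, 1)` at `-∞`. -/
structure IsDecayingPairAtBot (g k mu lam : ℝ) (ρ₀ : ℝ → ℝ) (ρm xbar : ℝ)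
    (U₃ U₄ : ℝ → Fin 4 → ℝ) : Prop where
  solution₃ : IsBoundedSystemSolution g k mu lam ρ₀ (Iio xbar) U₃
  solution₄ : IsBoundedSystemSolution g k mu lam ρ₀ (Iio xbar) U₄
  tendsto₃ : Tendsto (fun x => Real.exp (-(k * x)) • U₃ x) atBot
    (𝓝 ![(k ^ 3)⁻¹, (k ^ 2)⁻¹, k⁻¹, 1])
  tendsto₄ : Tendsto
    (fun x => Real.exp (-∫ y in xbar..x, sigma k mu lam (ρ₀ y)) • U₄ x) atBot
    (𝓝 ![(sigma k mu lam ρm ^ 3)⁻¹, (sigma k mu lam ρm ^ 2)⁻¹, (sigma k mu lam ρm)⁻¹, 1])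

/-! ### Boundary conditions -/

/-- The two relations `n₁₁ w₀ + n₁₂ w₁ + w₂ = 0` and `n₂₁ w₀ + n₂₂ w₁ + w₃ = 0`. -/
def BoundaryRelation (n : Matrix (Fin 2) (Fin 2) ℝ) (w : Fin 4 → ℝ) : Prop :=
  n 0 0 * w 0 + n 0 1 * w 1 + w 2 = 0 ∧ n 1 0 * w 0 + n 1 1 * w 1 + w 3 = 0

/-- `n₁₁ φ(x) + n₁₂ φ'(x) + φ''(x) = 0` and `n₂₁ φ(x) + n₂₂ φ'(x) + φ'''(x) = 0`, in the sense of
traces from within `Ω`. -/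
def BoundaryCondition (n : Matrix (Fin 2) (Fin 2) ℝ) (Ω : Set ℝ) (φ : ℝ → ℝ) (x : ℝ) : Prop :=
  ∃ t : Fin 4 → ℝ, HasTraces Ω φ x t ∧ BoundaryRelation n t

/-- `φ` solves the boundary value problem on `(xm, xp)` with coefficients `nm` at `xm` and `np` at
`xp`. -/
def IsBVPSolution (g k mu lam : ℝ) (ρ₀ : ℝ → ℝ) (xm xp : ℝ) (nm np : Matrix (Fin 2) (Fin 2) ℝ)
    (φ : ℝ → ℝ) : Prop :=
  IsH4Solution g k mu lam ρ₀ (Ioo xm xp) φ ∧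
  BoundaryCondition nm (Ioo xm xp) φ xm ∧ BoundaryCondition np (Ioo xm xp) φ xp

/-- On `I`, `Φ` is the first component of a linear combination of `V` and `W`. -/
def IsFirstComponentOfCombination (I : Set ℝ) (V W : ℝ → Fin 4 → ℝ) (Φ : ℝ → ℝ) : Prop :=
  ∃ c d : ℝ, ∀ᵐ x ∂(volume.restrict I), Φ x = (c • V x + d • W x) 0

end RayleighTaylor

end

/-! On an interval, an element of `H⁴` satisfying the equation is, up to null sets, the first
component of a classical solution of the first-order system: the equation expresses the fourth weak
derivative through continuous representatives of the lower ones
(`IsH4Solution.exists_isSystemSolution`, with the converse `IsSystemSolution.isH4Solution`). Its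
traces at an endpoint are then the limits of the four components (`hasTraces_iff`), so the whole
problem becomes one about solutions of a linear system with continuous coefficients.

The main point is that square integrable solutions on a half line form at most a plane. Divided by
`lam`, the equation reads `mu φ'''' - ((2 mu k² + lam ρ₀) φ')' + (...) φ = 0`, which is formally
self-adjoint. The Lagrange bracket of two solutions is therefore constant; for square integrable
solutions it is also integrable over a set of infinite measure, hence zero. The values of such
solutions at a point lie in an isotropic subspace of a four-dimensional symplectic space, of
dimension at most two (`IsSystemSolution.exists_combination`). The two decaying solutions are square
integrable and independent because `σ > k`, so they span this plane. Far enough out, the plane is a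
graph over the first two coordinates, and its two equations are the boundary relations.

Restriction from the line thus gives the boundary conditions. Conversely, these conditions say that
the traces of `φ` are values of decaying combinations; gluing those tails to `φ` gives a square
integrable solution on the line (`IsSystemSolution.exists_extension`), and uniqueness for the system
makes it the only one.

Existence of the decaying pairs is a Levinson argument. In coordinates that diagonalize the leading
matrix at each density, every remaining term carries the factor `ρ₀'`, which is integrable.
Variation of constants and a contraction near infinity (`exists_solution_tendsto`) yield solutions
with the prescribed asymptotics. The left end follows from the right end by the reflection `φ ↦
-φ(-x)`, `g ↦ -g`. -/

noncomputable section

namespace RayleighTaylor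

/-! ### Weak derivatives on an interval and their classical representatives -/

section WeakDerivatives

lemma setIntegral_eq_intervalIntegral {Ω : Set ℝ} {a b : ℝ} {f : ℝ → ℝ} (hab : a ≤ b)
    (hsub : Icc a b ⊆ Ω) (hf : ∀ x, x ∉ Ioo a b → f x = 0) :
    ∫ x in Ω, f x = ∫ x in a..b, f x := by
  rw [intervalIntegral.integral_of_le hab,
    setIntegral_eq_integral_of_forall_compl_eq_zero (fun x hx => hf x fun h => hx
      (hsub (Ioo_subset_Icc_self h))),
    setIntegral_eq_integral_of_forall_compl_eq_zero (fun x hx => hf x fun h => hx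
      (Ioo_subset_Ioc_self h))]

lemma LocallyIntegrableOn.integrable_mul {Ω : Set ℝ} {f η : ℝ → ℝ}
    (hf : LocallyIntegrableOn f Ω volume) (hη : Continuous η) (hc : HasCompactSupport η)
    (hs : tsupport η ⊆ Ω) : Integrable (fun x => f x * η x) volume := by
  have h1 : IntegrableOn f (tsupport η) volume := hf.integrableOn_compact_subset hs hc
  have h2 := h1.mul_continuousOn hη.continuousOn hc
  rwa [integrableOn_iff_integrable_of_support_subset] at h2
  intro x hx
  exact subset_tsupport _ (right_ne_zero_of_mul hx)

lemma LocallyIntegrableOn.congr_ae {Ω : Set ℝ} {f f' : ℝ → ℝ}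
    (hf : LocallyIntegrableOn f Ω volume) (h : f =ᵐ[volume.restrict Ω] f') :
    LocallyIntegrableOn f' Ω volume := by
  intro x hx
  obtain ⟨s, hs, hi⟩ := hf x hx
  refine ⟨s ∩ Ω, inter_mem hs self_mem_nhdsWithin, ?_⟩
  refine (hi.mono_set inter_subset_left).congr_fun_ae ?_
  exact ae_restrict_of_ae_restrict_of_subset inter_subset_right h

lemma IsWeakDeriv.congr_left {Ω : Set ℝ} {m : ℕ} {φ φ' ψ : ℝ → ℝ}
    (h : IsWeakDeriv Ω m φ ψ) (he : φ =ᵐ[volume.restrict Ω] φ') : IsWeakDeriv Ω m φ' ψ where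
  left_locallyIntegrable := LocallyIntegrableOn.congr_ae
    h.left_locallyIntegrable he
  right_locallyIntegrable := h.right_locallyIntegrable
  integral_eq η h1 h2 h3 := by
    rw [← h.integral_eq η h1 h2 h3]
    refine integral_congr_ae ?_
    filter_upwards [he] with x hx
    rw [hx]

lemma ae_eq_of_forall_integral_mul_eq {Ω : Set ℝ} (hΩ : IsOpen Ω) {ψ ψ' : ℝ → ℝ}
    (h : LocallyIntegrableOn ψ Ω volume) (h' : LocallyIntegrableOn ψ' Ω volume)
    (he : ∀ η : ℝ → ℝ, ContDiff ℝ ∞ η → HasCompactSupport η → tsupport η ⊆ Ω →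
      ∫ x in Ω, ψ x * η x = ∫ x in Ω, ψ' x * η x) :
    ψ =ᵐ[volume.restrict Ω] ψ' := by
  have := hΩ.ae_eq_zero_of_integral_contDiff_smul_eq_zero (h.sub h') (fun η h1 h2 h3 => by
    have e := he η h1 h2 h3
    have i1 := LocallyIntegrableOn.integrable_mul h h1.continuous h2 h3
    have i2 := LocallyIntegrableOn.integrable_mul h' h1.continuous h2 h3
    rw [setIntegral_eq_integral_of_forall_compl_eq_zero,
      setIntegral_eq_integral_of_forall_compl_eq_zero] at e
    · rw [← sub_eq_zero, ← integral_sub i1 i2] at e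
      rw [← e]
      congr 1 with x
      simp only [Pi.sub_apply, smul_eq_mul]
      ring
    all_goals
      intro x hx
      rw [image_eq_zero_of_notMem_tsupport fun h => hx (h3 h), mul_zero])
  rw [Filter.EventuallyEq, ae_restrict_iff' hΩ.measurableSet]
  filter_upwards [this] with x hx hxΩ
  exact sub_eq_zero.mp (hx hxΩ)

lemma IsWeakDeriv.ae_unique {Ω : Set ℝ} (hΩ : IsOpen Ω) {m : ℕ} {φ ψ ψ' : ℝ → ℝ}
    (h : IsWeakDeriv Ω m φ ψ) (h' : IsWeakDeriv Ω m φ ψ') : ψ =ᵐ[volume.restrict Ω] ψ' := by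
  refine ae_eq_of_forall_integral_mul_eq hΩ h.right_locallyIntegrable h'.right_locallyIntegrable ?_
  intro η h1 h2 h3
  have e1 := h.integral_eq η h1 h2 h3
  rw [h'.integral_eq η h1 h2 h3] at e1
  exact (mul_left_cancel₀ (pow_ne_zero _ (by norm_num)) e1).symm

lemma IsWeakDeriv.of_ae_eq {Ω : Set ℝ} (hΩ : IsOpen Ω) {φ F : ℝ → ℝ} (hF : ContinuousOn F Ω)
    (he : φ =ᵐ[volume.restrict Ω] F) : IsWeakDeriv Ω 0 φ F := by
  have hl := hF.locallyIntegrableOn (μ := volume) hΩ.measurableSet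
  refine IsWeakDeriv.congr_left ⟨hl, hl, ?_⟩ he.symm
  intro η _ _ _
  simp

/-- Integration by parts without boundary terms: `F η`, extended by zero, is differentiable on the
whole line, and both it and its derivative are integrable, so the integral of the derivative
vanishes. -/
lemma IsWeakDeriv.succ_of_hasDerivAt {Ω : Set ℝ} (hΩ : IsOpen Ω) {m : ℕ} {φ F G : ℝ → ℝ}
    (h : IsWeakDeriv Ω m φ F) (hd : ∀ x ∈ Ω, HasDerivAt F (G x) x) (hG : ContinuousOn G Ω) :
    IsWeakDeriv Ω (m + 1) φ G where
  left_locallyIntegrable := h.left_locallyIntegrable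
  right_locallyIntegrable := hG.locallyIntegrableOn hΩ.measurableSet
  integral_eq η h1 h2 h3 := by
    have hF : ContinuousOn F Ω := fun x hx => (hd x hx).continuousAt.continuousWithinAt
    have h1' : ContDiff ℝ ∞ (deriv η) := (contDiff_infty_iff_deriv.mp h1).2
    have h3' : tsupport (deriv η) ⊆ Ω := (tsupport_deriv_subset).trans h3
    rw [iteratedDeriv_succ', h.integral_eq _ h1' h2.deriv h3', pow_succ, mul_assoc, neg_one_mul]
    congr 1
    have i1 := LocallyIntegrableOn.integrable_mul (hG.locallyIntegrableOn (μ := volume)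
      hΩ.measurableSet) h1.continuous h2 h3
    have i2 := LocallyIntegrableOn.integrable_mul (hF.locallyIntegrableOn (μ := volume)
      hΩ.measurableSet) h1'.continuous h2.deriv h3'
    have i3 := LocallyIntegrableOn.integrable_mul (hF.locallyIntegrableOn (μ := volume)
      hΩ.measurableSet) h1.continuous h2 h3
    rw [setIntegral_eq_integral_of_forall_compl_eq_zero,
      setIntegral_eq_integral_of_forall_compl_eq_zero]
    · rw [eq_neg_iff_add_eq_zero, add_comm, ← integral_add i1 i2]
      refine integral_eq_zero_of_hasDerivAt_of_integrable (f := fun x => F x * η x) ?_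
        (i1.add i2) i3
      intro x
      by_cases hx : x ∈ tsupport η
      · exact (hd x (h3 hx)).mul (h1.differentiable (by simp) x).hasDerivAt
      · have e : (fun x => F x * η x) =ᶠ[𝓝 x] fun _ => 0 := by
          filter_upwards [(isClosed_tsupport η).isOpen_compl.mem_nhds hx] with y hy
          rw [image_eq_zero_of_notMem_tsupport hy, mul_zero]
        have := (hasDerivAt_const x (0:ℝ)).congr_of_eventuallyEq e
        rw [image_eq_zero_of_notMem_tsupport hx,
          image_eq_zero_of_notMem_tsupport fun h => hx (tsupport_deriv_subset h)]
        simpa using this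
    all_goals
      intro x hx
    · rw [image_eq_zero_of_notMem_tsupport fun h => hx (h3 h), mul_zero]
    · rw [image_eq_zero_of_notMem_tsupport fun h => hx (h3' h), mul_zero]

lemma IsWeakDeriv.one_of_succ {Ω : Set ℝ} {m : ℕ} {φ ψ ψ' : ℝ → ℝ}
    (h : IsWeakDeriv Ω m φ ψ) (h' : IsWeakDeriv Ω (m + 1) φ ψ') : IsWeakDeriv Ω 1 ψ ψ' where
  left_locallyIntegrable := h.right_locallyIntegrable
  right_locallyIntegrable := h'.right_locallyIntegrable
  integral_eq η h1 h2 h3 := by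
    have h1' : ContDiff ℝ ∞ (deriv η) := (contDiff_infty_iff_deriv.mp h1).2
    have h3' : tsupport (deriv η) ⊆ Ω := (tsupport_deriv_subset).trans h3
    have e1 := h.integral_eq _ h1' h2.deriv h3'
    have e2 := h'.integral_eq _ h1 h2 h3
    rw [iteratedDeriv_succ', e1, pow_succ, mul_assoc] at e2
    have := mul_left_cancel₀ (pow_ne_zero _ (by norm_num)) e2
    simpa using this

/-- Places the support of a test function inside a compact interval, where interval integrals and
integration by parts for absolutely continuous functions are available. -/
lemma exists_Ioo_of_isCompact {Ω K : Set ℝ} (hΩ : IsOpen Ω) (hC : Ω.OrdConnected)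
    (hK : IsCompact K) (hne : K.Nonempty) (hs : K ⊆ Ω) :
    ∃ a b, a < b ∧ Icc a b ⊆ Ω ∧ K ⊆ Ioo a b := by
  obtain ⟨α, hα, hα'⟩ := hK.exists_isLeast hne
  obtain ⟨β, hβ, hβ'⟩ := hK.exists_isGreatest hne
  obtain ⟨a, ha, ha'⟩ := (mem_nhdsLE_iff_exists_Icc_subset.mp
    (mem_nhdsWithin_of_mem_nhds (hΩ.mem_nhds (hs hα))) : _)
  obtain ⟨b, hb, hb'⟩ := (mem_nhdsGE_iff_exists_Icc_subset.mp
    (mem_nhdsWithin_of_mem_nhds (hΩ.mem_nhds (hs hβ))) : _)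
  have hαβ := hα' hβ
  refine ⟨a, b, by linarith, hC.out (ha' ⟨le_rfl, ha.le⟩) (hb' ⟨hb.le, le_rfl⟩), ?_⟩
  intro x hx
  exact ⟨ha.trans_le (hα' hx), (hβ' hx).trans_lt hb⟩

/-- A function whose weak derivative on an open interval vanishes is constant. -/
lemma exists_ae_eq_const {Ω : Set ℝ} (hΩ : IsOpen Ω) (hC : Ω.OrdConnected) {c : ℝ} (hc : c ∈ Ω)
    {h : ℝ → ℝ} (hl : LocallyIntegrableOn h Ω volume)
    (h0 : ∀ η : ℝ → ℝ, ContDiff ℝ ∞ η → HasCompactSupport η → tsupport η ⊆ Ω →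
      ∫ x in Ω, h x * deriv η x = 0) :
    ∃ C : ℝ, h =ᵐ[volume.restrict Ω] fun _ => C := by
  obtain ⟨ε, hε, hball⟩ := Metric.isOpen_iff.mp hΩ c hc
  let B : ContDiffBump c := ⟨ε / 4, ε / 2, by positivity, by linarith⟩
  let χ : ℝ → ℝ := B.normed volume
  have χ1 : ContDiff ℝ ∞ χ := B.contDiff_normed
  have χ2 : HasCompactSupport χ := B.hasCompactSupport_normed
  have χ3 : tsupport χ ⊆ Ω := by
    rw [B.tsupport_normed_eq]
    exact (Metric.closedBall_subset_ball (by simp only [B]; linarith)).trans hball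
  have χ4 : ∫ x, χ x = 1 := B.integral_normed
  have hzero : ∀ (θ : ℝ → ℝ) x, tsupport θ ⊆ Ω → x ∉ Ω → h x * θ x = 0 := fun θ x hs hx => by
    rw [image_eq_zero_of_notMem_tsupport fun h => hx (hs h), mul_zero]
  refine ⟨∫ x in Ω, h x * χ x, ?_⟩
  refine ae_eq_of_forall_integral_mul_eq hΩ hl
    (continuousOn_const.locallyIntegrableOn hΩ.measurableSet) ?_
  intro θ θ1 θ2 θ3
  set I := ∫ x, θ x with hI
  -- Subtracting `I χ` makes the test function mean-zero, so that its primitive again has compact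
  -- support and can be tested against `h`.
  let δ : ℝ → ℝ := fun x => θ x - I * χ x
  have δ1 : ContDiff ℝ ∞ δ := θ1.sub (contDiff_const.mul χ1)
  obtain ⟨a, b, hab, hsub, hK⟩ := exists_Ioo_of_isCompact hΩ hC (θ2.isCompact.union χ2.isCompact)
    (by
      have : (Function.support χ).Nonempty := by
        by_contra hne
        rw [not_nonempty_iff_eq_empty, Function.support_eq_empty_iff] at hne
        simp [hne] at χ4
      exact (this.mono (subset_tsupport χ)).mono subset_union_right) (union_subset θ3 χ3)
  have δ0 : ∀ x, x ∉ Ioo a b → δ x = 0 := fun x hx => by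
    simp only [δ]
    rw [image_eq_zero_of_notMem_tsupport fun h => hx (hK (Or.inl h)),
      image_eq_zero_of_notMem_tsupport fun h => hx (hK (Or.inr h))]
    simp
  have iθ : Integrable θ volume := θ1.continuous.integrable_of_hasCompactSupport θ2
  have iχ : Integrable χ volume := χ1.continuous.integrable_of_hasCompactSupport χ2
  have δi : ∫ x in a..b, δ x = 0 := by
    rw [← setIntegral_eq_intervalIntegral (Ω := univ) hab.le (subset_univ _) δ0]
    simp only [δ, Measure.restrict_univ]
    rw [integral_sub iθ (iχ.const_mul I), integral_const_mul, χ4, mul_one, sub_self]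
  let η : ℝ → ℝ := fun x => ∫ t in a..x, δ t
  have ηd : ∀ x, HasDerivAt η (δ x) x := fun x =>
    (δ1.continuous.integral_hasStrictDerivAt a x).hasDerivAt
  have ηd' : deriv η = δ := funext fun x => (ηd x).deriv
  have η1 : ContDiff ℝ ∞ η := by
    rw [contDiff_infty_iff_deriv, ηd']
    exact ⟨fun x => (ηd x).differentiableAt, δ1⟩
  have η0 : ∀ x, x ∉ Icc a b → η x = 0 := by
    intro x hx
    rcases lt_or_ge x a with h | h
    · simp only [η]
      rw [intervalIntegral.integral_symm, intervalIntegral.integral_congr (g := fun _ => 0)]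
      · simp
      · intro t ht
        rw [uIcc_of_le h.le] at ht
        exact δ0 t fun h' => by linarith [h'.1, ht.2]
    · have hxb : b < x := by
        by_contra h'
        exact hx ⟨h, not_lt.mp h'⟩
      simp only [η]
      rw [← intervalIntegral.integral_add_adjacent_intervals (b := b)
        (δ1.continuous.intervalIntegrable _ _) (δ1.continuous.intervalIntegrable _ _), δi,
        zero_add, intervalIntegral.integral_congr (g := fun _ => 0)]
      · simp
      · intro t ht
        rw [uIcc_of_le hxb.le] at ht
        exact δ0 t fun h' => by linarith [h'.2, ht.1]
  have ηs : tsupport η ⊆ Icc a b :=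
    closure_minimal (fun x hx => by_contra fun h => hx (η0 x h)) isClosed_Icc
  have η2 : HasCompactSupport η := HasCompactSupport.of_support_subset_isCompact isCompact_Icc
    ((subset_tsupport η).trans ηs)
  have key := h0 η η1 η2 (ηs.trans hsub)
  rw [ηd', setIntegral_eq_integral_of_forall_compl_eq_zero (fun x hx => by
    simp only [δ]
    rw [mul_sub, hzero θ x θ3 hx, ← mul_assoc, mul_comm _ I, mul_assoc, hzero χ x χ3 hx]; simp)]
    at key
  have i1 := LocallyIntegrableOn.integrable_mul hl θ1.continuous θ2 θ3
  have i2 := LocallyIntegrableOn.integrable_mul hl χ1.continuous χ2 χ3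
  have e : (fun x => h x * δ x) = fun x => h x * θ x - I * (h x * χ x) := by
    funext x
    simp only [δ]
    ring
  rw [e, integral_sub i1 (i2.const_mul I), integral_const_mul, sub_eq_zero] at key
  rw [integral_const_mul]
  rw [setIntegral_eq_integral_of_forall_compl_eq_zero (fun x hx => hzero θ x θ3 hx),
    setIntegral_eq_integral_of_forall_compl_eq_zero (fun x hx => hzero χ x χ3 hx),
    setIntegral_eq_integral_of_forall_compl_eq_zero (fun x hx =>
      image_eq_zero_of_notMem_tsupport fun h => hx (θ3 h)), key]
  ring

/-- A function with a locally integrable weak derivative on an open interval is a primitive of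
it. -/
lemma IsWeakDeriv.exists_primitive {Ω : Set ℝ} (hΩ : IsOpen Ω) (hC : Ω.OrdConnected)
    (hne : Ω.Nonempty) {f g : ℝ → ℝ} (h : IsWeakDeriv Ω 1 f g) :
    ∃ F : ℝ → ℝ, f =ᵐ[volume.restrict Ω] F ∧ ContinuousOn F Ω ∧
      ∀ x ∈ Ω, ∀ y ∈ Ω, F y - F x = ∫ t in x..y, g t := by
  obtain ⟨c, hc⟩ := hne
  have hint : ∀ x ∈ Ω, ∀ y ∈ Ω, IntervalIntegrable g volume x y := fun x hx y hy => by
    rw [intervalIntegrable_iff']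
    exact h.right_locallyIntegrable.integrableOn_compact_subset (hC.uIcc_subset hx hy)
      isCompact_uIcc
  let G : ℝ → ℝ := fun x => ∫ t in c..x, g t
  have hG : ContinuousOn G Ω := by
    intro x hx
    obtain ⟨a, b, hab, hsub, hK⟩ := exists_Ioo_of_isCompact hΩ hC
      ((isCompact_singleton (x := x)).union (isCompact_singleton (x := c))) ⟨x, by simp⟩
      (by intro y hy; rcases hy with hy | hy <;> simp at hy <;> rwa [hy])
    have hx' : x ∈ Ioo a b := hK (by simp)
    have hc' : c ∈ Ioo a b := hK (by simp)
    have := (hint a (hsub ⟨le_rfl, hab.le⟩) b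
      (hsub ⟨hab.le, le_rfl⟩)).absolutelyContinuousOnInterval_intervalIntegral (c := c)
      (by rw [uIcc_of_le hab.le]; exact Ioo_subset_Icc_self hc')
    have := this.continuousOn
    rw [uIcc_of_le hab.le] at this
    exact ((this x (Ioo_subset_Icc_self hx')).continuousAt
      (Icc_mem_nhds hx'.1 hx'.2)).continuousWithinAt
  have hGl := hG.locallyIntegrableOn (μ := volume) hΩ.measurableSet
  -- `G` need not be differentiable everywhere, but it is absolutely continuous, which suffices for
  -- integration by parts. Hence `f - G` has zero weak derivative and is constant.
  have parts : ∀ η : ℝ → ℝ, ContDiff ℝ ∞ η → HasCompactSupport η → tsupport η ⊆ Ω →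
      ∫ x in Ω, G x * deriv η x = - ∫ x in Ω, g x * η x := by
    intro η h1 h2 h3
    obtain ⟨a, b, hab, hsub, hK⟩ := exists_Ioo_of_isCompact hΩ hC
      (h2.isCompact.union (isCompact_singleton (x := c))) ⟨c, by simp⟩
      (union_subset h3 (by simpa using hc))
    have hη0 : ∀ x, x ∉ Ioo a b → η x = 0 := fun x hx =>
      image_eq_zero_of_notMem_tsupport fun h => hx (hK (Or.inl h))
    have hη0' : ∀ x, x ∉ Ioo a b → deriv η x = 0 := fun x hx =>
      image_eq_zero_of_notMem_tsupport fun h => hx (hK (Or.inl (tsupport_deriv_subset h)))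
    have hc' : c ∈ uIcc a b := by
      rw [uIcc_of_le hab.le]; exact Ioo_subset_Icc_self (hK (by simp))
    have gi := hint a (hsub ⟨le_rfl, hab.le⟩) b (hsub ⟨hab.le, le_rfl⟩)
    have ac := gi.absolutelyContinuousOnInterval_intervalIntegral hc'
    have acη : AbsolutelyContinuousOnInterval η a b :=
      (h1.contDiffOn.of_le (by exact_mod_cast le_top)).absolutelyContinuousOnInterval
    have := ac.integral_mul_deriv_eq_deriv_mul acη
    rw [setIntegral_eq_intervalIntegral hab.le hsub (fun x hx => by rw [hη0' x hx, mul_zero]),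
      setIntegral_eq_intervalIntegral hab.le hsub (fun x hx => by rw [hη0 x hx, mul_zero]), this,
      hη0 a (by simp), hη0 b (by simp), mul_zero, mul_zero, sub_zero, zero_sub]
    congr 1
    refine intervalIntegral.integral_congr_ae ?_
    filter_upwards [gi.ae_hasDerivAt_integral] with x hx hx'
    rw [(hx (uIoc_subset_uIcc hx') c hc').deriv]
  obtain ⟨C, hCst⟩ := exists_ae_eq_const hΩ hC hc (h.left_locallyIntegrable.sub hGl) (by
    intro η h1 h2 h3
    have h1' : ContDiff ℝ ∞ (deriv η) := (contDiff_infty_iff_deriv.mp h1).2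
    have h3' : tsupport (deriv η) ⊆ Ω := (tsupport_deriv_subset).trans h3
    have e := h.integral_eq η h1 h2 h3
    rw [iteratedDeriv_one, pow_one, neg_one_mul, ← parts η h1 h2 h3] at e
    have i1 := LocallyIntegrableOn.integrable_mul h.left_locallyIntegrable h1'.continuous
      h2.deriv h3'
    have i2 := LocallyIntegrableOn.integrable_mul hGl h1'.continuous h2.deriv h3'
    rw [← sub_eq_zero, ← integral_sub i1.integrableOn i2.integrableOn] at e
    rw [← e]
    refine integral_congr_ae (ae_of_all _ fun x => ?_)
    simp only [Pi.sub_apply]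
    ring)
  refine ⟨fun x => G x + C, ?_, hG.add continuousOn_const, ?_⟩
  · filter_upwards [hCst] with x hx
    simp only [Pi.sub_apply] at hx
    linarith
  · intro x hx y hy
    simp only [G]
    rw [add_sub_add_right_eq_sub, intervalIntegral.integral_interval_sub_left
      (hint c hc y hy) (hint c hc x hx)]

/-- The bootstrap step: once the density of a primitive has a continuous representative, the
primitive is classically differentiable at every point. -/
lemma hasDerivAt_of_sub_eq_integral {Ω : Set ℝ} (hΩ : IsOpen Ω) (hC : Ω.OrdConnected)
    {F g G : ℝ → ℝ} (hF : ∀ x ∈ Ω, ∀ y ∈ Ω, F y - F x = ∫ t in x..y, g t)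
    (he : g =ᵐ[volume.restrict Ω] G) (hG : ContinuousOn G Ω) :
    ∀ x ∈ Ω, HasDerivAt F (G x) x := by
  intro x hx
  have e : ∀ y ∈ Ω, F y = F x + ∫ t in x..y, G t := by
    intro y hy
    rw [← sub_eq_iff_eq_add', hF x hx y hy]
    refine intervalIntegral.integral_congr_ae ?_
    rw [Filter.EventuallyEq, ae_restrict_iff' hΩ.measurableSet] at he
    filter_upwards [he] with t ht ht'
    exact ht (hC.uIcc_subset hx hy (uIoc_subset_uIcc ht'))
  have hd : HasDerivAt (fun y => F x + ∫ t in x..y, G t) (G x) x := by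
    refine HasDerivAt.const_add _ ?_
    refine intervalIntegral.integral_hasDerivAt_right (by simp) ?_
      (hG.continuousAt (hΩ.mem_nhds hx))
    exact hG.stronglyMeasurableAtFilter hΩ x hx
  refine hd.congr_of_eventuallyEq ?_
  filter_upwards [hΩ.mem_nhds hx] with y hy using e y hy

end WeakDerivatives

/-! ### Equivalence of the Sobolev equation with the classical system, and traces -/

section Regularity

/-- `U' = (L + ρ₀' R) U` on `I`. -/
def IsSystemSolution (g k mu lam : ℝ) (ρ₀ : ℝ → ℝ) (I : Set ℝ) (U : ℝ → Fin 4 → ℝ) : Prop :=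
  ∀ x ∈ I, HasDerivAt U
    ((matL k mu lam ρ₀ x + deriv ρ₀ x • matR g k mu lam).mulVec (U x)) x

/-- The last component of the right hand side of the system: the fourth derivative in terms of the
lower ones. -/
def fourthDeriv (g k mu lam : ℝ) (ρ₀ : ℝ → ℝ) (x : ℝ) (w : Fin 4 → ℝ) : ℝ :=
  (-(lam * k ^ 2 * ρ₀ x / mu) - k ^ 4 + deriv ρ₀ x * (g * k ^ 2 / (lam * mu))) * w 0 +
    deriv ρ₀ x * (lam / mu) * w 1 + (lam * ρ₀ x / mu + 2 * k ^ 2) * w 2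

variable {g k mu lam : ℝ} {ρ₀ : ℝ → ℝ} {Ω I : Set ℝ} {φ : ℝ → ℝ} {U V W : ℝ → Fin 4 → ℝ}

lemma mulVec_system (g k mu lam : ℝ) (ρ₀ : ℝ → ℝ) (x : ℝ) (w : Fin 4 → ℝ) :
    (matL k mu lam ρ₀ x + deriv ρ₀ x • matR g k mu lam).mulVec w =
      ![w 1, w 2, w 3, fourthDeriv g k mu lam ρ₀ x w] := by
  ext j
  fin_cases j <;>
    simp [matL, matR, Matrix.mulVec, dotProduct, Fin.sum_univ_four, fourthDeriv]

lemma isSystemSolution_iff : IsSystemSolution g k mu lam ρ₀ I U ↔ ∀ x ∈ I,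
    HasDerivAt (fun x => U x 0) (U x 1) x ∧ HasDerivAt (fun x => U x 1) (U x 2) x ∧
    HasDerivAt (fun x => U x 2) (U x 3) x ∧
    HasDerivAt (fun x => U x 3) (fourthDeriv g k mu lam ρ₀ x (U x)) x := by
  refine forall₂_congr fun x _ => ?_
  rw [mulVec_system, hasDerivAt_pi]
  simp [Fin.forall_fin_succ]

lemma IsSystemSolution.mono (h : IsSystemSolution g k mu lam ρ₀ I U) {J : Set ℝ} (hJ : J ⊆ I) :
    IsSystemSolution g k mu lam ρ₀ J U := fun x hx => h x (hJ hx)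

lemma IsSystemSolution.continuousOn (h : IsSystemSolution g k mu lam ρ₀ I U) :
    ContinuousOn U I := fun x hx => (h x hx).continuousAt.continuousWithinAt

lemma IsSystemSolution.continuousOn_apply (h : IsSystemSolution g k mu lam ρ₀ I U) (j : Fin 4) :
    ContinuousOn (fun x => U x j) I := (continuousOn_pi.mp h.continuousOn) j

lemma continuousOn_fourthDeriv (hρ : ContDiff ℝ 1 ρ₀) (hU : ContinuousOn U I) :
    ContinuousOn (fun x => fourthDeriv g k mu lam ρ₀ x (U x)) I := by
  have h1 := hρ.continuous
  have h2 := hρ.continuous_deriv le_rfl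
  have h3 := continuousOn_pi.mp hU
  have := h3 0
  have := h3 1
  have := h3 2
  unfold fourthDeriv
  fun_prop

lemma IsWeakDeriv.ae_eq_of_order_zero (hΩ : IsOpen Ω) {ψ : ℝ → ℝ} (h : IsWeakDeriv Ω 0 φ ψ) :
    φ =ᵐ[volume.restrict Ω] ψ :=
  ae_eq_of_forall_integral_mul_eq hΩ h.left_locallyIntegrable h.right_locallyIntegrable
    fun η h1 h2 h3 => by simpa using h.integral_eq η h1 h2 h3

/-- Weak derivatives of the first component of a solution of the system. -/
lemma IsSystemSolution.isWeakDeriv (hΩ : IsOpen Ω) (hρ : ContDiff ℝ 1 ρ₀)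
    (h : IsSystemSolution g k mu lam ρ₀ Ω W) (he : φ =ᵐ[volume.restrict Ω] fun x => W x 0) :
    (∀ j : Fin 4, IsWeakDeriv Ω j φ (fun x => W x j)) ∧
      IsWeakDeriv Ω 4 φ (fun x => fourthDeriv g k mu lam ρ₀ x (W x)) := by
  have hd := isSystemSolution_iff.mp h
  have w0 : IsWeakDeriv Ω 0 φ (fun x => W x 0) := .of_ae_eq hΩ (h.continuousOn_apply 0) he
  have w1 := w0.succ_of_hasDerivAt hΩ (fun x hx => (hd x hx).1) (h.continuousOn_apply 1)
  have w2 := w1.succ_of_hasDerivAt hΩ (fun x hx => (hd x hx).2.1) (h.continuousOn_apply 2)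
  have w3 := w2.succ_of_hasDerivAt hΩ (fun x hx => (hd x hx).2.2.1) (h.continuousOn_apply 3)
  have w4 := w3.succ_of_hasDerivAt hΩ (fun x hx => (hd x hx).2.2.2)
    (continuousOn_fourthDeriv hρ h.continuousOn)
  refine ⟨fun j => ?_, w4⟩
  fin_cases j
  exacts [w0, w1, w2, w3]

/-- The equation is divided by `lam * mu`. Left to right it yields continuity of the fourth
derivative; right to left it recovers the equation from the system. -/
lemma fourthDeriv_spec (hmu : mu ≠ 0) (hlam : lam ≠ 0) (x : ℝ) (w : Fin 4 → ℝ) (y : ℝ) :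
    lam ^ 2 * (k ^ 2 * ρ₀ x * w 0 - (deriv ρ₀ x * w 1 + ρ₀ x * w 2)) +
      lam * mu * (y - 2 * k ^ 2 * w 2 + k ^ 4 * w 0) = g * k ^ 2 * deriv ρ₀ x * w 0 ↔
    y = fourthDeriv g k mu lam ρ₀ x w := by
  have e : lam ^ 2 * (k ^ 2 * ρ₀ x * w 0 - (deriv ρ₀ x * w 1 + ρ₀ x * w 2)) +
      lam * mu * (y - 2 * k ^ 2 * w 2 + k ^ 4 * w 0) - g * k ^ 2 * deriv ρ₀ x * w 0 =
      lam * mu * (y - fourthDeriv g k mu lam ρ₀ x w) := by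
    unfold fourthDeriv
    field_simp
    ring
  rw [← sub_eq_zero, e, mul_eq_zero, sub_eq_zero]
  simp [hmu, hlam]

lemma isWeakDeriv_mul_profile (hΩ : IsOpen Ω) (hρ : ContDiff ℝ 1 ρ₀) {F G f : ℝ → ℝ}
    (hF : ∀ x ∈ Ω, HasDerivAt F (G x) x) (hG : ContinuousOn G Ω)
    (he : f =ᵐ[volume.restrict Ω] F) :
    IsWeakDeriv Ω 1 (fun x => ρ₀ x * f x) (fun x => deriv ρ₀ x * F x + ρ₀ x * G x) := by
  have h1 := hρ.continuous
  have h2 := hρ.continuous_deriv le_rfl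
  have hFc : ContinuousOn F Ω := fun x hx => (hF x hx).continuousAt.continuousWithinAt
  have w0 : IsWeakDeriv Ω 0 (fun x => ρ₀ x * f x) (fun x => ρ₀ x * F x) :=
    .of_ae_eq hΩ (by fun_prop) (by filter_upwards [he] with x hx; rw [hx])
  refine w0.succ_of_hasDerivAt hΩ (fun x hx => ?_) (by fun_prop)
  exact ((hρ.differentiable (by norm_num)) x).hasDerivAt.mul (hF x hx)

theorem IsH4Solution.exists_isSystemSolution (hΩ : IsOpen Ω) (hC : Ω.OrdConnected)
    (hne : Ω.Nonempty) (hρ : ContDiff ℝ 1 ρ₀) (hmu : mu ≠ 0) (hlam : lam ≠ 0)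
    (h : IsH4Solution g k mu lam ρ₀ Ω φ) :
    ∃ W : ℝ → Fin 4 → ℝ, IsSystemSolution g k mu lam ρ₀ Ω W ∧
      (φ =ᵐ[volume.restrict Ω] fun x => W x 0) ∧
      ∀ j, MemLp (fun x => W x j) 2 (volume.restrict Ω) := by
  obtain ⟨hS, φ₁, φ₂, φ₄, q, h1, h2, h4, hq, heq⟩ := h
  obtain ⟨ψ₀, d0, m0⟩ := hS 0 (by norm_num)
  obtain ⟨ψ₁, d1, m1⟩ := hS 1 (by norm_num)
  obtain ⟨ψ₂, d2, m2⟩ := hS 2 (by norm_num)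
  obtain ⟨ψ₃, d3, m3⟩ := hS 3 (by norm_num)
  -- The weak derivatives of orders 0 to 3 get continuous representatives, each a primitive of the
  -- next order. Only the derivative of `F₃` is not yet known to be continuous.
  obtain ⟨F₃, e3, c3, p3⟩ := (d3.one_of_succ h4).exists_primitive hΩ hC hne
  obtain ⟨F₂, e2, c2, p2⟩ := (d2.one_of_succ d3).exists_primitive hΩ hC hne
  obtain ⟨F₁, e1, c1, p1⟩ := (d1.one_of_succ d2).exists_primitive hΩ hC hne
  obtain ⟨F₀, e0, c0, p0⟩ := (d0.one_of_succ d1).exists_primitive hΩ hC hne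
  have D2 := hasDerivAt_of_sub_eq_integral hΩ hC p2 e3 c3
  have D1 := hasDerivAt_of_sub_eq_integral hΩ hC p1 e2 c2
  have D0 := hasDerivAt_of_sub_eq_integral hΩ hC p0 e1 c1
  have hφ0 : φ =ᵐ[volume.restrict Ω] F₀ := (d0.ae_eq_of_order_zero hΩ).trans e0
  have hφ1 : φ₁ =ᵐ[volume.restrict Ω] F₁ := (h1.ae_unique hΩ d1).trans e1
  have hφ2 : φ₂ =ᵐ[volume.restrict Ω] F₂ := (h2.ae_unique hΩ d2).trans e2
  have hq' := hq.ae_unique hΩ (isWeakDeriv_mul_profile hΩ hρ D1 c2 hφ1)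
  let W : ℝ → Fin 4 → ℝ := fun x => ![F₀ x, F₁ x, F₂ x, F₃ x]
  have hWc : ContinuousOn W Ω := by
    rw [continuousOn_pi]
    intro j
    fin_cases j
    exacts [c0, c1, c2, c3]
  -- The equation closes the bootstrap: `φ₄` equals a continuous expression in the lower
  -- derivatives, so `F₃` is differentiable too.
  have hφ4 : φ₄ =ᵐ[volume.restrict Ω] fun x => fourthDeriv g k mu lam ρ₀ x (W x) := by
    filter_upwards [heq, hφ0, hφ2, hq'] with x hx x0 x2 xq
    rw [x0, x2, xq] at hx
    exact (fourthDeriv_spec hmu hlam x (W x) (φ₄ x)).mp hx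
  have D3 := hasDerivAt_of_sub_eq_integral hΩ hC p3 hφ4 (continuousOn_fourthDeriv hρ hWc)
  refine ⟨W, isSystemSolution_iff.mpr fun x hx => ⟨D0 x hx, D1 x hx, D2 x hx, D3 x hx⟩, hφ0, ?_⟩
  intro j
  fin_cases j
  exacts [m0.ae_eq e0, m1.ae_eq e1, m2.ae_eq e2, m3.ae_eq e3]

lemma memLp_bounded_mul {f c : ℝ → ℝ} {C : ℝ} {ν : Measure ℝ} (hc : Continuous c)
    (hC : ∀ x, |c x| ≤ C) (hf : MemLp f 2 ν) : MemLp (fun x => c x * f x) 2 ν := by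
  refine MemLp.of_le_mul (c := C) hf (hc.aestronglyMeasurable.mul hf.1) (ae_of_all _ fun x => ?_)
  rw [norm_mul]
  exact mul_le_mul_of_nonneg_right (hC x) (norm_nonneg _)

/-- Square integrability of the fourth derivative is not assumed: it is a combination of the lower
ones with coefficients bounded through `ρ₀` and `ρ₀'`. -/
theorem IsSystemSolution.isH4Solution (hΩ : IsOpen Ω) (hρ : ContDiff ℝ 1 ρ₀) (hmu : mu ≠ 0)
    (hlam : lam ≠ 0) {M M' : ℝ} (hM : ∀ x, |ρ₀ x| ≤ M) (hM' : ∀ x, |deriv ρ₀ x| ≤ M')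
    (h : IsSystemSolution g k mu lam ρ₀ Ω W) (he : φ =ᵐ[volume.restrict Ω] fun x => W x 0)
    (hL : ∀ j, MemLp (fun x => W x j) 2 (volume.restrict Ω)) :
    IsH4Solution g k mu lam ρ₀ Ω φ := by
  obtain ⟨hw, hw4⟩ := h.isWeakDeriv hΩ hρ he
  have hd := isSystemSolution_iff.mp h
  have c1 := hρ.continuous
  have c2 := hρ.continuous_deriv le_rfl
  refine ⟨?_, fun x => W x 1, fun x => W x 2, _, _, hw 1, hw 2, hw4,
    isWeakDeriv_mul_profile hΩ hρ (fun x hx => (hd x hx).2.1) (h.continuousOn_apply 2)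
      (ae_eq_refl _), ?_⟩
  · have hL4 : MemLp (fun x => fourthDeriv g k mu lam ρ₀ x (W x)) 2 (volume.restrict Ω) := by
      have r (j) := memLp_bounded_mul c1 hM (hL j)
      have r' (j) := memLp_bounded_mul c2 hM' (hL j)
      have := ((((r 0).const_mul (-(lam * k ^ 2 / mu))).add ((hL 0).const_mul (-k ^ 4))).add
        (((r' 0).const_mul (g * k ^ 2 / (lam * mu))).add ((r' 1).const_mul (lam / mu)))).add
        (((r 2).const_mul (lam / mu)).add ((hL 2).const_mul (2 * k ^ 2)))
      refine this.ae_eq (ae_of_all _ fun x => ?_)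
      simp only [Pi.add_apply, fourthDeriv]
      ring
    intro j hj
    interval_cases j
    exacts [⟨_, hw 0, hL 0⟩, ⟨_, hw 1, hL 1⟩, ⟨_, hw 2, hL 2⟩, ⟨_, hw 3, hL 3⟩, ⟨_, hw4, hL4⟩]
  · filter_upwards [he] with x hx
    rw [hx]
    exact (fourthDeriv_spec hmu hlam x (W x) _).mpr rfl

/-- For a continuous function, discarding null sets does not weaken a limit, since a nonempty open
set of exceptional points would have positive measure. -/
lemma tendsto_nhdsWithin_of_tendsto_ae (hΩ : IsOpen Ω) {ψ F : ℝ → ℝ} {x t : ℝ}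
    (hF : ContinuousOn F Ω) (he : ψ =ᵐ[volume.restrict Ω] F)
    (h : Tendsto ψ (𝓝[Ω] x ⊓ ae volume) (𝓝 t)) : Tendsto F (𝓝[Ω] x) (𝓝 t) := by
  -- Closed neighbourhoods are used so that the points where `F` leaves `S` form an open set.
  rw [(closed_nhds_basis t).tendsto_right_iff]
  rintro S ⟨hS, hScl⟩
  have h1 : ∀ᶠ y in 𝓝[Ω] x ⊓ ae volume, ψ y ∈ S := h hS
  rw [eventually_inf] at h1
  obtain ⟨A, hA, B, hB, hAB⟩ := h1
  obtain ⟨O, hO, hxO, hOA⟩ := mem_nhdsWithin.mp hA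
  rw [eventually_nhdsWithin_iff]
  filter_upwards [hO.mem_nhds hxO] with y hy hyΩ
  by_contra hyS
  have hN : IsOpen (O ∩ (Ω ∩ F ⁻¹' Sᶜ)) :=
    hO.inter (hF.isOpen_inter_preimage hΩ hScl.isOpen_compl)
  have hpos := hN.measure_pos volume ⟨y, hy, hyΩ, hyS⟩
  rw [Filter.EventuallyEq, ae_restrict_iff' hΩ.measurableSet] at he
  have : volume (O ∩ (Ω ∩ F ⁻¹' Sᶜ)) = 0 := by
    refine measure_mono_null ?_ (ae_iff.mp (he.and hB))
    rintro z ⟨hz1, hz2, hz3⟩ ⟨hz4, hz5⟩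
    apply hz3
    show F z ∈ S
    rw [← hz4 hz2]
    exact hAB z ⟨hOA ⟨hz1, hz2⟩, hz5⟩
  exact hpos.ne' this

lemma hasTraces_iff (hΩ : IsOpen Ω) (hρ : ContDiff ℝ 1 ρ₀)
    (h : IsSystemSolution g k mu lam ρ₀ Ω W) (he : φ =ᵐ[volume.restrict Ω] fun x => W x 0)
    {x : ℝ} {t : Fin 4 → ℝ} : HasTraces Ω φ x t ↔ Tendsto W (𝓝[Ω] x) (𝓝 t) := by
  have hw := (h.isWeakDeriv hΩ hρ he).1
  rw [tendsto_pi_nhds]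
  refine forall_congr' fun j => ⟨?_, fun hj => ⟨_, hw j, hj.mono_left inf_le_left⟩⟩
  rintro ⟨ψ, h1, h2⟩
  exact tendsto_nhdsWithin_of_tendsto_ae hΩ (h.continuousOn_apply j) (h1.ae_unique hΩ (hw j)) h2

end Regularity

/-! ### The Lagrange bracket and square integrable solutions on half lines -/

section HalfLines

variable {g k mu lam : ℝ} {ρ₀ : ℝ → ℝ} {Ω I : Set ℝ} {φ : ℝ → ℝ} {U V W : ℝ → Fin 4 → ℝ}

lemma abs_mulVec_le {ι : Type*} [Fintype ι] {A : Matrix ι ι ℝ} {b : ℝ}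
    (hA : ∀ i j, |A i j| ≤ b) (v : ι → ℝ) (i : ι) :
    |A.mulVec v i| ≤ Fintype.card ι * b * ‖v‖ := by
  calc |A.mulVec v i| ≤ ∑ j, |A i j * v j| := Finset.abs_sum_le_sum_abs _ _
    _ ≤ ∑ _j : ι, b * ‖v‖ := by
        refine Finset.sum_le_sum fun j _ => ?_
        rw [abs_mul]
        exact mul_le_mul (hA i j) (norm_le_pi_norm v j) (abs_nonneg _)
          ((abs_nonneg _).trans (hA i j))
    _ = Fintype.card ι * b * ‖v‖ := by simp [mul_assoc]

lemma continuous_systemMatrix (hρ : ContDiff ℝ 1 ρ₀) :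
    Continuous fun x => matL k mu lam ρ₀ x + deriv ρ₀ x • matR g k mu lam := by
  have c1 := hρ.continuous
  have c2 := hρ.continuous_deriv le_rfl
  refine continuous_matrix fun i j => ?_
  fin_cases i <;> fin_cases j <;> simp [matL, matR] <;> fun_prop

theorem IsSystemSolution.eqOn (hI : I.OrdConnected) (hρ : ContDiff ℝ 1 ρ₀)
    (hU : IsSystemSolution g k mu lam ρ₀ I U) (hV : IsSystemSolution g k mu lam ρ₀ I V)
    {x₀ : ℝ} (hx₀ : x₀ ∈ I) (h : U x₀ = V x₀) : EqOn U V I := by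
  have hA := continuous_systemMatrix (g := g) (k := k) (mu := mu) (lam := lam) hρ
  set A := fun x => matL k mu lam ρ₀ x + deriv ρ₀ x • matR g k mu lam with hAdef
  have hlip : ∀ x y : ℝ, ∃ K : NNReal, ∀ t ∈ Icc x y,
      LipschitzOnWith K (fun w => (A t).mulVec w) univ := by
    intro x y
    have hc : Continuous fun t => ∑ i, ∑ j, |A t i j| := by
      refine continuous_finsetSum _ fun i _ => continuous_finsetSum _ fun j _ => ?_
      exact (hA.matrix_elem i j).abs
    obtain ⟨C, hC⟩ := isCompact_Icc.exists_bound_of_continuousOn (s := Icc x y) hc.continuousOn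
    -- In the supremum norm a 4 by 4 matrix with entries bounded by `C` has norm at most `4 * C`.
    refine ⟨Real.toNNReal (4 * C), fun t ht => LipschitzOnWith.of_dist_le_mul fun w _ w' _ => ?_⟩
    have hentry : ∀ i j, |A t i j| ≤ C := by
      intro i j
      refine le_trans ?_ ((le_abs_self _).trans (hC t ht))
      refine (Finset.single_le_sum (f := fun j => |A t i j|) (fun _ _ => abs_nonneg _)
        (Finset.mem_univ j)).trans ?_
      exact Finset.single_le_sum (f := fun i => ∑ j, |A t i j|)
        (fun _ _ => Finset.sum_nonneg fun _ _ => abs_nonneg _) (Finset.mem_univ i)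
    have hC0 : 0 ≤ C := (abs_nonneg _).trans (hentry 0 0)
    rw [dist_eq_norm, dist_eq_norm, ← Matrix.mulVec_sub, Real.coe_toNNReal _ (by positivity)]
    refine (pi_norm_le_iff_of_nonneg (by positivity)).mpr fun i => ?_
    simpa using abs_mulVec_le hentry (w - w') i
  intro y hy
  rcases le_total x₀ y with hxy | hxy
  · obtain ⟨K, hK⟩ := hlip x₀ y
    have hs : Icc x₀ y ⊆ I := hI.out hx₀ hy
    exact ODE_solution_unique_of_mem_Icc_right (v := fun t w => (A t).mulVec w)
      (s := fun _ => univ) (fun t ht => hK t (Ico_subset_Icc_self ht))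
      (hU.continuousOn.mono hs)
      (fun t ht => (hU t (hs (Ico_subset_Icc_self ht))).hasDerivWithinAt) (fun _ _ => mem_univ _)
      (hV.continuousOn.mono hs)
      (fun t ht => (hV t (hs (Ico_subset_Icc_self ht))).hasDerivWithinAt) (fun _ _ => mem_univ _)
      h ⟨hxy, le_rfl⟩
  · obtain ⟨K, hK⟩ := hlip y x₀
    have hs : Icc y x₀ ⊆ I := hI.out hy hx₀
    exact ODE_solution_unique_of_mem_Icc_left (v := fun t w => (A t).mulVec w)
      (s := fun _ => univ) (fun t ht => hK t (Ioc_subset_Icc_self ht))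
      (hU.continuousOn.mono hs)
      (fun t ht => (hU t (hs (Ioc_subset_Icc_self ht))).hasDerivWithinAt) (fun _ _ => mem_univ _)
      (hV.continuousOn.mono hs)
      (fun t ht => (hV t (hs (Ioc_subset_Icc_self ht))).hasDerivWithinAt) (fun _ _ => mem_univ _)
      h ⟨le_rfl, hxy⟩

lemma IsSystemSolution.combination (hU : IsSystemSolution g k mu lam ρ₀ I U)
    (hV : IsSystemSolution g k mu lam ρ₀ I V) (c d : ℝ) :
    IsSystemSolution g k mu lam ρ₀ I (fun x => c • U x + d • V x) := by
  intro x hx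
  rw [Matrix.mulVec_add, Matrix.mulVec_smul, Matrix.mulVec_smul]
  exact ((hU x hx).const_smul c).add ((hV x hx).const_smul d)

/-- The Lagrange bracket of the fourth-order operator. -/
def bracket (k mu lam r : ℝ) (w u : Fin 4 → ℝ) : ℝ :=
  mu * (w 3 * u 0 - w 0 * u 3 - w 2 * u 1 + w 1 * u 2) -
    (2 * mu * k ^ 2 + lam * r) * (w 1 * u 0 - w 0 * u 1)

/-- Formal self-adjointness: the zeroth-order terms, including the one with `g ρ₀'`, are symmetric
in the two solutions and cancel. The term `lam ρ₀' φ'` in the system is cancelled by the derivative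
of the coefficient of the second part of the bracket. -/
lemma IsSystemSolution.hasDerivAt_bracket (hρ : ContDiff ℝ 1 ρ₀) (hmu : mu ≠ 0) (hlam : lam ≠ 0)
    (hU : IsSystemSolution g k mu lam ρ₀ I U) (hV : IsSystemSolution g k mu lam ρ₀ I V)
    {x : ℝ} (hx : x ∈ I) :
    HasDerivAt (fun x => bracket k mu lam (ρ₀ x) (U x) (V x)) 0 x := by
  obtain ⟨u0, u1, u2, u3⟩ := isSystemSolution_iff.mp hU x hx
  obtain ⟨v0, v1, v2, v3⟩ := isSystemSolution_iff.mp hV x hx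
  have hr := ((hρ.differentiable (by norm_num)) x).hasDerivAt
  have := (((((u3.mul v0).sub (u0.mul v3)).sub (u2.mul v1)).add (u1.mul v2)).const_mul mu).sub
    (((hr.const_mul lam).const_add (2 * mu * k ^ 2)).mul ((u1.mul v0).sub (u0.mul v1)))
  refine this.congr_deriv ?_
  simp only [fourthDeriv, Pi.mul_apply, Pi.sub_apply]
  field_simp
  ring

/-- The bracket is a constant and, with `ρ₀` bounded, a sum of products of square integrable
functions. An integrable constant on a set of infinite measure is zero. -/
lemma IsSystemSolution.bracket_eq_zero (hO : IsOpen I) (hI : I.OrdConnected)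
    (hvol : volume I = ⊤) (hρ : ContDiff ℝ 1 ρ₀) (hmu : mu ≠ 0) (hlam : lam ≠ 0) {M : ℝ}
    (hM : ∀ x, |ρ₀ x| ≤ M)
    (hU : IsSystemSolution g k mu lam ρ₀ I U) (hV : IsSystemSolution g k mu lam ρ₀ I V)
    (lU : ∀ j, MemLp (fun x => U x j) 2 (volume.restrict I))
    (lV : ∀ j, MemLp (fun x => V x j) 2 (volume.restrict I)) {x : ℝ} (hx : x ∈ I) :
    bracket k mu lam (ρ₀ x) (U x) (V x) = 0 := by
  have hd := fun y (hy : y ∈ I) => hU.hasDerivAt_bracket hρ hmu hlam hV hy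
  have hconst : ∀ y ∈ I, bracket k mu lam (ρ₀ y) (U y) (V y) =
      bracket k mu lam (ρ₀ x) (U x) (V x) := fun y hy =>
    hO.is_const_of_deriv_eq_zero hI.isPreconnected
      (fun z hz => (hd z hz).differentiableAt.differentiableWithinAt)
      (fun z hz => (hd z hz).deriv) hy hx
  set C := bracket k mu lam (ρ₀ x) (U x) (V x)
  have hint : IntegrableOn (fun _ => C) I volume := by
    have i (j l) : Integrable (fun y => U y j * V y l) (volume.restrict I) :=
      (lU j).integrable_mul (lV l)
    have i' (j l) : Integrable (fun y => ρ₀ y * U y j * V y l) (volume.restrict I) :=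
      (memLp_bounded_mul hρ.continuous hM (lU j)).integrable_mul (lV l)
    have := (((((i 3 0).sub (i 0 3)).sub (i 2 1)).add (i 1 2)).const_mul mu).sub
      ((((i 1 0).sub (i 0 1)).const_mul (2 * mu * k ^ 2)).add
      (((i' 1 0).sub (i' 0 1)).const_mul lam))
    refine this.congr ?_
    filter_upwards [ae_restrict_mem hO.measurableSet] with y hy
    rw [← hconst y hy]
    simp only [bracket, Pi.add_apply, Pi.sub_apply]
    ring
  rw [integrableOn_const_iff] at hint
  rcases hint with h | h
  · simpa using h
  · rw [hvol] at h
    exact absurd h (lt_irrefl _)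

/-- Subtract the combination of `a` and `b` that matches the first two coordinates of `w`. The
remainder `(0, 0, r2, r3)` has zero bracket with `a` and with `b`, which is a linear system for `r2,
r3` whose determinant is, up to sign, that of `hdet`. -/
lemma exists_combination_of_bracket {a b w : Fin 4 → ℝ} {r : ℝ} (hmu : mu ≠ 0)
    (hdet : a 0 * b 1 - a 1 * b 0 ≠ 0) (hab : bracket k mu lam r a b = 0)
    (ha : bracket k mu lam r w a = 0) (hb : bracket k mu lam r w b = 0) :
    ∃ c d : ℝ, w = c • a + d • b := by
  set D := a 0 * b 1 - a 1 * b 0 with hD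
  set c := (w 0 * b 1 - w 1 * b 0) / D with hc
  set d := (a 0 * w 1 - a 1 * w 0) / D with hd
  have e0 : w 0 = c * a 0 + d * b 0 := by
    rw [hc, hd]; field_simp; rw [hD]; ring
  have e1 : w 1 = c * a 1 + d * b 1 := by
    rw [hc, hd]; field_simp; rw [hD]; ring
  set r2 := w 2 - c * a 2 - d * b 2 with hr2
  set r3 := w 3 - c * a 3 - d * b 3 with hr3
  have w2 : w 2 = r2 + c * a 2 + d * b 2 := by rw [hr2]; ring
  have w3 : w 3 = r3 + c * a 3 + d * b 3 := by rw [hr3]; ring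
  have p1 : mu * (r3 * a 0 - r2 * a 1) = 0 := by
    unfold bracket at *
    rw [e0, e1, w2, w3] at ha
    linear_combination ha + d * hab
  have p2 : mu * (r3 * b 0 - r2 * b 1) = 0 := by
    unfold bracket at *
    rw [e0, e1, w2, w3] at hb
    linear_combination hb - c * hab
  have q1 := (mul_eq_zero.mp p1).resolve_left hmu
  have q2 := (mul_eq_zero.mp p2).resolve_left hmu
  have z2 : r2 = 0 := by
    have : r2 * D = 0 := by rw [hD]; linear_combination b 0 * q1 - a 0 * q2
    exact (mul_eq_zero.mp this).resolve_right hdet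
  have z3 : r3 = 0 := by
    have : r3 * D = 0 := by rw [hD]; linear_combination b 1 * q1 - a 1 * q2
    exact (mul_eq_zero.mp this).resolve_right hdet
  refine ⟨c, d, ?_⟩
  ext j
  fin_cases j
  · simpa using e0
  · simpa using e1
  · simpa [z2] using w2
  · simpa [z3] using w3

/-- A square integrable solution on a half line is a combination of any two independent ones. -/
theorem IsSystemSolution.exists_combination (hO : IsOpen I) (hI : I.OrdConnected)
    (hvol : volume I = ⊤) (hρ : ContDiff ℝ 1 ρ₀) (hmu : mu ≠ 0) (hlam : lam ≠ 0) {M : ℝ}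
    (hM : ∀ x, |ρ₀ x| ≤ M)
    (hU : IsSystemSolution g k mu lam ρ₀ I U) (hV : IsSystemSolution g k mu lam ρ₀ I V)
    (hW : IsSystemSolution g k mu lam ρ₀ I W)
    (lU : ∀ j, MemLp (fun x => U x j) 2 (volume.restrict I))
    (lV : ∀ j, MemLp (fun x => V x j) 2 (volume.restrict I))
    (lW : ∀ j, MemLp (fun x => W x j) 2 (volume.restrict I)) {x : ℝ} (hx : x ∈ I)
    (hdet : U x 0 * V x 1 - U x 1 * V x 0 ≠ 0) :
    ∃ c d : ℝ, ∀ y ∈ I, W y = c • U y + d • V y := by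
  obtain ⟨c, d, h⟩ := exists_combination_of_bracket hmu hdet
    (hU.bracket_eq_zero hO hI hvol hρ hmu hlam hM hV lU lV hx)
    (hW.bracket_eq_zero hO hI hvol hρ hmu hlam hM hU lW lU hx)
    (hW.bracket_eq_zero hO hI hvol hρ hmu hlam hM hV lW lV hx)
  exact ⟨c, d, hW.eqOn hI hρ (hU.combination hV c d) hx h⟩

/-- The determinant condition makes the plane a graph over the coordinates 0 and 1; Cramer's rule
gives the coefficients. -/
lemma exists_boundaryRelation_iff {a b : Fin 4 → ℝ} (hdet : a 0 * b 1 - a 1 * b 0 ≠ 0) :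
    ∃ n : Matrix (Fin 2) (Fin 2) ℝ, ∀ w : Fin 4 → ℝ,
      BoundaryRelation n w ↔ w ∈ Submodule.span ℝ {a, b} := by
  set D := a 0 * b 1 - a 1 * b 0 with hD
  refine ⟨!![(a 1 * b 2 - a 2 * b 1) / D, (a 2 * b 0 - a 0 * b 2) / D;
    (a 1 * b 3 - a 3 * b 1) / D, (a 3 * b 0 - a 0 * b 3) / D], fun w => ?_⟩
  rw [Submodule.mem_span_pair]
  simp only [BoundaryRelation, Matrix.of_apply, Matrix.cons_val', Matrix.cons_val_zero,
    Matrix.cons_val_one, Matrix.cons_val_fin_one]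
  constructor
  · rintro ⟨h2, h3⟩
    refine ⟨(w 0 * b 1 - w 1 * b 0) / D, (a 0 * w 1 - a 1 * w 0) / D, ?_⟩
    field_simp at h2 h3
    ext j
    fin_cases j <;> simp <;> field_simp
    · rw [hD]; ring
    · rw [hD]; ring
    · linear_combination -h2
    · linear_combination -h3
  · rintro ⟨c, d, rfl⟩
    simp only [Pi.add_apply, Pi.smul_apply, smul_eq_mul]
    constructor <;> field_simp <;> rw [hD] <;> ring

end HalfLines

/-! ### Independence and square integrability of decaying pairs; reflection -/

section DecayingPairs

variable {g k mu lam ρp ρm a : ℝ} {ρ₀ : ℝ → ℝ} {I : Set ℝ} {U V : ℝ → Fin 4 → ℝ}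

lemma lt_sigma (hmu : 0 < mu) (hlam : 0 < lam) {r : ℝ} (hr : 0 < r) :
    k < sigma k mu lam r := by
  refine Real.lt_sqrt_of_sq_lt ?_
  have : 0 < lam / mu * r := by positivity
  linarith

lemma continuous_sigma (hρ : Continuous ρ₀) : Continuous fun x => sigma k mu lam (ρ₀ x) := by
  unfold sigma
  fun_prop

/-- A solution with exponential decay at `+∞` is square integrable. -/
lemma memLp_Ioi_of_tendsto (hk : 0 < k) (hU : ContinuousOn U (Ioi a)) {θ : ℝ → ℝ} {C : ℝ}
    {v : Fin 4 → ℝ} (hθ : ∀ x > a, k * x - C ≤ θ x)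
    (h : Tendsto (fun x => Real.exp (θ x) • U x) atTop (𝓝 v)) {x₀ : ℝ} (hx₀ : a < x₀)
    (j : Fin 4) : MemLp (fun x => U x j) 2 (volume.restrict (Ioi x₀)) := by
  have hc : ContinuousOn (fun x => U x j) (Ici x₀) :=
    ((continuousOn_pi.mp hU) j).mono fun x hx => hx₀.trans_le hx
  rw [memLp_two_iff_integrable_sq
    ((hc.mono Ioi_subset_Ici_self).aestronglyMeasurable measurableSet_Ioi)]
  refine integrable_of_isBigO_exp_neg (b := 2 * k) (by positivity) (hc.pow 2) ?_
  have hj : (fun x => Real.exp (θ x) * U x j) =O[atTop] fun _ => (1 : ℝ) := by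
    have := (tendsto_pi_nhds.mp h) j
    exact this.isBigO_one ℝ
  have h1 : (fun x => U x j) =O[atTop] fun x => Real.exp (-k * x) := by
    have e : (fun x => U x j) = fun x => Real.exp (-θ x) * (Real.exp (θ x) * U x j) := by
      funext x
      rw [← mul_assoc, ← Real.exp_add]
      simp
    have h2 : (fun x => Real.exp (-θ x)) =O[atTop] fun x => Real.exp (-k * x) := by
      refine Asymptotics.IsBigO.of_bound (Real.exp C) ?_
      filter_upwards [Ioi_mem_atTop a] with x hx
      rw [Real.norm_of_nonneg (Real.exp_pos _).le, Real.norm_of_nonneg (Real.exp_pos _).le,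
        ← Real.exp_add]
      exact Real.exp_le_exp.mpr (by linarith [hθ x hx])
    rw [e]
    simpa using h2.mul hj
  refine (h1.pow 2).congr_right fun x => ?_
  rw [← Real.exp_nat_mul]
  congr 1
  push_cast
  ring

/-- Since `σ₀ ≥ k`, the second solution decays at least like `e^{-kx}`, so one integrability
criterion serves both. -/
lemma le_integral_sigma (hmu : 0 < mu) (hlam : 0 < lam) (hρ : Continuous ρ₀)
    (hpos : ∀ x, 0 < ρ₀ x) {x : ℝ} (hx : a ≤ x) :
    k * x - k * a ≤ ∫ y in a..x, sigma k mu lam (ρ₀ y) := by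
  have := intervalIntegral.integral_mono_on (μ := volume) hx
    (intervalIntegrable_const (c := k)) ((continuous_sigma hρ).intervalIntegrable a x)
    (fun y _ => (lt_sigma (k := k) (mu := mu) (lam := lam) hmu hlam (hpos y)).le)
  rw [intervalIntegral.integral_const, smul_eq_mul] at this
  linarith

lemma IsDecayingPairAtTop.exists_independent_memLp (hk : 0 < k) (hmu : 0 < mu) (hlam : 0 < lam)
    (hρ : ContDiff ℝ 1 ρ₀) (hpos : ∀ x, 0 < ρ₀ x) (hρp : 0 < ρp)
    (h : IsDecayingPairAtTop g k mu lam ρ₀ ρp a U V) :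
    ∃ x₀ > a, (∀ x ≥ x₀, U x 0 * V x 1 - U x 1 * V x 0 ≠ 0) ∧
      (∀ j, MemLp (fun x => U x j) 2 (volume.restrict (Ioi x₀))) ∧
      ∀ j, MemLp (fun x => V x j) 2 (volume.restrict (Ioi x₀)) := by
  have hs := lt_sigma (k := k) hmu hlam hρp
  have t1 := tendsto_pi_nhds.mp h.tendsto₁
  have t2 := tendsto_pi_nhds.mp h.tendsto₂
  have hdet := ((t1 0).mul (t2 1)).sub ((t1 1).mul (t2 0))
  -- Rescaling by the two exponentials does not affect vanishing of the determinant, and the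
  -- rescaled determinant tends to `(k - s) / (k³ s³)`, which is nonzero because `s > k`.
  have hne : ∀ᶠ x in atTop, U x 0 * V x 1 - U x 1 * V x 0 ≠ 0 := by
    refine (hdet.eventually_ne (b₂ := 0) ?_).mono fun x hx h0 => hx ?_
    · simp only [Matrix.cons_val_zero, Matrix.cons_val_one]
      set s := sigma k mu lam ρp
      have hs0 : 0 < s := hk.trans hs
      have : -(k ^ 3)⁻¹ * (s ^ 2)⁻¹ - (k ^ 2)⁻¹ * -(s ^ 3)⁻¹ = (k - s) / (k ^ 3 * s ^ 3) := by
        field_simp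
        ring
      rw [this]
      exact div_ne_zero (by linarith) (by positivity)
    · simp only [Pi.smul_apply, smul_eq_mul]
      linear_combination Real.exp (k * x) * Real.exp (∫ y in a..x, sigma k mu lam (ρ₀ y)) * h0
  obtain ⟨x₁, hx₁⟩ := eventually_atTop.mp hne
  -- The summand `a + 1` keeps the closed half line from `x₀` inside the open one where the
  -- solutions are given; they need not extend continuously to `a`.
  refine ⟨max x₁ (a + 1), by simp, fun x hx => hx₁ x ((le_max_left _ _).trans hx), ?_, ?_⟩
  · exact memLp_Ioi_of_tendsto hk (fun x hx => (h.solution₁.1 x hx).continuousAt.continuousWithinAt)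
      (C := 0) (fun x _ => by linarith) h.tendsto₁ (by simp)
  · exact memLp_Ioi_of_tendsto hk (fun x hx => (h.solution₂.1 x hx).continuousAt.continuousWithinAt)
      (fun x hx => le_integral_sigma hmu hlam hρ.continuous hpos hx.le) h.tendsto₂ (by simp)

/-- The derivatives of `-φ(-x)` in terms of those of `φ`. -/
def reflect (U : ℝ → Fin 4 → ℝ) (x : ℝ) : Fin 4 → ℝ :=
  ![-U (-x) 0, U (-x) 1, -U (-x) 2, U (-x) 3]

/-- Under `x ↦ -x` the even-order operator and `(ρ₀ φ')'` are preserved, while `ρ₀'` changes sign;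
replacing `g` by `-g` compensates. For this reason the results at `+∞` are stated for any real `g`.
-/
lemma IsSystemSolution.reflect {J : Set ℝ} (hJ : ∀ x ∈ J, -x ∈ I)
    (hU : IsSystemSolution g k mu lam ρ₀ I U) :
    IsSystemSolution (-g) k mu lam (fun x => ρ₀ (-x)) J (reflect U) := by
  refine isSystemSolution_iff.mpr fun x hx => ?_
  obtain ⟨h0, h1, h2, h3⟩ := isSystemSolution_iff.mp hU (-x) (hJ x hx)
  have key : ∀ {f : ℝ → ℝ} {f' : ℝ}, HasDerivAt f f' (-x) →
      HasDerivAt (fun y => f (-y)) (-f') x := fun hf => by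
    simpa [Function.comp_def] using hf.scomp x (hasDerivAt_neg x)
  refine ⟨?_, ?_, ?_, ?_⟩
  · simpa [RayleighTaylor.reflect] using (key h0).fun_neg
  · simpa [RayleighTaylor.reflect] using key h1
  · simpa [RayleighTaylor.reflect] using (key h2).fun_neg
  · refine (key h3).congr_deriv ?_
    have : deriv (fun x => ρ₀ (-x)) x = -deriv ρ₀ (-x) := deriv_comp_neg ρ₀ x
    simp only [fourthDeriv, RayleighTaylor.reflect, this]
    simp
    ring

lemma norm_reflect_le (x : ℝ) : ‖reflect U x‖ ≤ ‖U (-x)‖ := by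
  refine (pi_norm_le_iff_of_nonneg (norm_nonneg _)).mpr fun j => ?_
  fin_cases j <;> simpa [reflect] using norm_le_pi_norm (U (-x)) _

lemma IsBoundedSystemSolution.reflect {J : Set ℝ} (hJ : ∀ x ∈ J, -x ∈ I)
    (hU : IsBoundedSystemSolution g k mu lam ρ₀ I U) :
    IsBoundedSystemSolution (-g) k mu lam (fun x => ρ₀ (-x)) J (reflect U) := by
  refine ⟨IsSystemSolution.reflect hJ hU.1, ?_⟩
  obtain ⟨C, hC⟩ := hU.2
  exact ⟨C, fun x hx => (norm_reflect_le x).trans (hC _ (hJ x hx))⟩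

lemma tendsto_smul_reflect {l l' : Filter ℝ} {θ θ' : ℝ → ℝ} {v : Fin 4 → ℝ}
    (h : Tendsto (fun x => Real.exp (θ x) • U x) l (𝓝 v)) (hl : Tendsto (fun x => -x) l' l)
    (hθ : ∀ x, θ (-x) = θ' x) :
    Tendsto (fun x => Real.exp (θ' x) • reflect U x) l' (𝓝 ![-v 0, v 1, -v 2, v 3]) := by
  have h' := tendsto_pi_nhds.mp (h.comp hl)
  rw [tendsto_pi_nhds]
  intro j
  have := h' j
  have hn := (h' j).neg
  fin_cases j
  · simpa [reflect, hθ] using hn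
  · simpa [reflect, hθ] using this
  · simpa [reflect, hθ] using hn
  · simpa [reflect, hθ] using this

lemma IsDecayingPairAtBot.reflect (h : IsDecayingPairAtBot g k mu lam ρ₀ ρm a U V) :
    IsDecayingPairAtTop (-g) k mu lam (fun x => ρ₀ (-x)) ρm (-a) (reflect U) (reflect V) where
  solution₁ := h.solution₃.reflect fun x hx => by
    rw [mem_Iio]; rw [mem_Ioi] at hx; linarith
  solution₂ := h.solution₄.reflect fun x hx => by
    rw [mem_Iio]; rw [mem_Ioi] at hx; linarith
  tendsto₁ := by
    simpa using tendsto_smul_reflect h.tendsto₃ tendsto_neg_atTop_atBot (θ' := fun x => k * x)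
      (by simp)
  tendsto₂ := by
    have := tendsto_smul_reflect h.tendsto₄ tendsto_neg_atTop_atBot
      (θ' := fun x => ∫ y in -a..x, sigma k mu lam (ρ₀ (-y))) (fun x => by
        rw [intervalIntegral.integral_comp_neg (fun y => sigma k mu lam (ρ₀ y)), neg_neg,
          intervalIntegral.integral_symm, neg_neg])
    simpa using this

lemma IsDecayingPairAtTop.reflect (h : IsDecayingPairAtTop g k mu lam ρ₀ ρp a U V) :
    IsDecayingPairAtBot (-g) k mu lam (fun x => ρ₀ (-x)) ρp (-a) (reflect U) (reflect V) where
  solution₃ := h.solution₁.reflect fun x hx => by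
    rw [mem_Ioi]; rw [mem_Iio] at hx; linarith
  solution₄ := h.solution₂.reflect fun x hx => by
    rw [mem_Ioi]; rw [mem_Iio] at hx; linarith
  tendsto₃ := by
    simpa using tendsto_smul_reflect h.tendsto₁ tendsto_neg_atBot_atTop
      (θ' := fun x => -(k * x)) (by simp)
  tendsto₄ := by
    have := tendsto_smul_reflect h.tendsto₂ tendsto_neg_atBot_atTop
      (θ' := fun x => -∫ y in -a..x, sigma k mu lam (ρ₀ (-y))) (fun x => by
        rw [intervalIntegral.integral_comp_neg (fun y => sigma k mu lam (ρ₀ y)), neg_neg,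
          intervalIntegral.integral_symm])
    simpa using this

lemma memLp_Iio_of_reflect {x₀ : ℝ}
    (h : ∀ j, MemLp (fun x => reflect U x j) 2 (volume.restrict (Ioi x₀))) (j : Fin 4) :
    MemLp (fun x => U x j) 2 (volume.restrict (Iio (-x₀))) := by
  have hp : MeasurePreserving (fun x : ℝ => -x) (volume.restrict (Iio (-x₀)))
      (volume.restrict (Ioi x₀)) := by
    have := (Measure.measurePreserving_neg (volume : Measure ℝ)).restrict_preimage
      (measurableSet_Ioi (a := x₀))
    simpa using this
  have hj := (h j).comp_measurePreserving hp
  fin_cases j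
  · simpa [reflect, Function.comp_def, Pi.neg_def] using hj.neg
  · simpa [reflect, Function.comp_def] using hj
  · simpa [reflect, Function.comp_def, Pi.neg_def] using hj.neg
  · simpa [reflect, Function.comp_def] using hj

lemma IsDecayingPairAtBot.exists_independent_memLp (hk : 0 < k) (hmu : 0 < mu) (hlam : 0 < lam)
    (hρ : ContDiff ℝ 1 ρ₀) (hpos : ∀ x, 0 < ρ₀ x) (hρm : 0 < ρm)
    (h : IsDecayingPairAtBot g k mu lam ρ₀ ρm a U V) :
    ∃ x₀ < a, (∀ x ≤ x₀, U x 0 * V x 1 - U x 1 * V x 0 ≠ 0) ∧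
      (∀ j, MemLp (fun x => U x j) 2 (volume.restrict (Iio x₀))) ∧
      ∀ j, MemLp (fun x => V x j) 2 (volume.restrict (Iio x₀)) := by
  obtain ⟨x₀, hx₀, hdet, lU, lV⟩ := h.reflect.exists_independent_memLp hk hmu hlam (hρ.comp contDiff_neg)
    (fun x => hpos (-x)) hρm
  refine ⟨-x₀, by linarith, fun x hx h0 => hdet (-x) (by linarith) ?_,
    memLp_Iio_of_reflect lU, memLp_Iio_of_reflect lV⟩
  simp [RayleighTaylor.reflect]
  linarith

end DecayingPairs

/-! ### Asymptotic integration of perturbed diagonal systems -/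

section Levinson

/-- `S` assigns to an integrable `f` a solution of `z' = d z + f` that is bounded by the integral of
`|f|` on `[a, ∞)` and tends to `0` at `+∞`. -/
structure IsDecayingSolver (d : ℝ → ℝ) (a : ℝ) (S : (ℝ → ℝ) → ℝ → ℝ) : Prop where
  hasDerivAt : ∀ f, Continuous f → IntegrableOn f (Ioi a) → ∀ x,
    HasDerivAt (S f) (d x * S f x + f x) x
  abs_le : ∀ f, Continuous f → IntegrableOn f (Ioi a) → ∀ x ≥ a, |S f x| ≤ ∫ t in Ioi a, |f t|
  tendsto : ∀ f, Continuous f → IntegrableOn f (Ioi a) → Tendsto (S f) atTop (𝓝 0)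
  sub : ∀ f f', Continuous f → Continuous f' → IntegrableOn f (Ioi a) → IntegrableOn f' (Ioi a) →
    ∀ x, S (fun t => f t - f' t) x = S f x - S f' x

/-- Variation of constants. The free constant `C` selects the solution: the integral over the half
line when `d ≥ 0`, and `0` when `d ≤ -δ`. -/
lemma hasDerivAt_exp_mul_primitive {d f : ℝ → ℝ} (hd : Continuous d) (hf : Continuous f)
    (a C x : ℝ) :
    HasDerivAt (fun x => Real.exp (∫ t in a..x, d t) *
        ((∫ t in a..x, Real.exp (-∫ s in a..t, d s) * f t) - C))
      (d x * (Real.exp (∫ t in a..x, d t) *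
        ((∫ t in a..x, Real.exp (-∫ s in a..t, d s) * f t) - C)) + f x) x := by
  have hD : ∀ x, HasDerivAt (fun x => ∫ t in a..x, d t) (d x) x := fun x =>
    (hd.integral_hasStrictDerivAt a x).hasDerivAt
  have hDc : Continuous fun x => ∫ t in a..x, d t :=
    continuous_iff_continuousAt.mpr fun x => (hD x).continuousAt
  have hc : Continuous fun t => Real.exp (-∫ s in a..t, d s) * f t := by fun_prop
  have h2 := (hc.integral_hasStrictDerivAt a x).hasDerivAt
  refine ((hD x).exp.mul (h2.sub_const C)).congr_deriv ?_
  rw [Real.exp_neg]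
  field_simp

lemma continuous_primitive {d : ℝ → ℝ} (hd : Continuous d) (a : ℝ) :
    Continuous fun x => ∫ t in a..x, d t :=
  continuous_iff_continuousAt.mpr fun x =>
    (hd.integral_hasStrictDerivAt a x).hasDerivAt.continuousAt

/-- This choice of constant amounts to integrating back from infinity. The kernel `exp (-∫_x^t d)`
is at most 1 for `t ≥ x`, so the solution is bounded by the tail of the integral of `|f|`. -/
lemma isDecayingSolver_of_nonneg {d : ℝ → ℝ} (hd : Continuous d) (h0 : ∀ x, 0 ≤ d x) (a : ℝ) :
    IsDecayingSolver d a fun f x => Real.exp (∫ t in a..x, d t) *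
      ((∫ t in a..x, Real.exp (-∫ s in a..t, d s) * f t) -
        ∫ t in Ioi a, Real.exp (-∫ s in a..t, d s) * f t) := by
  have hDc := continuous_primitive hd a
  have hint : ∀ f, Continuous f → IntegrableOn f (Ioi a) →
      IntegrableOn (fun t => Real.exp (-∫ s in a..t, d s) * f t) (Ioi a) := by
    intro f hf hi
    refine Integrable.mono' hi.norm (by fun_prop) ?_
    filter_upwards [ae_restrict_mem measurableSet_Ioi] with t ht
    have : 0 ≤ ∫ s in a..t, d s :=
      intervalIntegral.integral_nonneg (le_of_lt ht) fun s _ => h0 s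
    rw [norm_mul, Real.norm_of_nonneg (Real.exp_pos _).le]
    exact mul_le_of_le_one_left (norm_nonneg _) (Real.exp_le_one_iff.mpr (by linarith))
  have hbound : ∀ f, Continuous f → IntegrableOn f (Ioi a) → ∀ x ≥ a,
      |Real.exp (∫ t in a..x, d t) * ((∫ t in a..x, Real.exp (-∫ s in a..t, d s) * f t) -
        ∫ t in Ioi a, Real.exp (-∫ s in a..t, d s) * f t)| ≤
      (∫ t in Ioi a, |f t|) - ∫ t in a..x, |f t| := by
    intro f hf hi x hx
    have hi' := hint f hf hi
    have e1 := intervalIntegral.integral_Ioi_sub_Ioi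
      (f := fun t => Real.exp (-∫ s in a..t, d s) * f t) hi' hx
    have e2 := intervalIntegral.integral_Ioi_sub_Ioi (f := fun t => |f t|) hi.abs hx
    rw [← e1, ← e2, sub_sub_cancel_left, sub_sub_cancel, mul_neg, abs_neg,
      ← integral_const_mul]
    refine (abs_integral_le_integral_abs).trans ?_
    refine integral_mono_of_nonneg (ae_of_all _ fun t => abs_nonneg _)
      (IntegrableOn.mono_set (f := fun t => |f t|) hi.abs (Ioi_subset_Ioi hx)) ?_
    filter_upwards [ae_restrict_mem measurableSet_Ioi] with t ht
    rw [← mul_assoc, ← Real.exp_add, abs_mul, Real.abs_exp]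
    refine mul_le_of_le_one_left (abs_nonneg _) (Real.exp_le_one_iff.mpr ?_)
    have := intervalIntegral.integral_add_adjacent_intervals (hd.intervalIntegrable (μ := volume)
      a x) (hd.intervalIntegrable x t)
    have : 0 ≤ ∫ s in x..t, d s :=
      intervalIntegral.integral_nonneg (le_of_lt ht) fun s _ => h0 s
    linarith
  refine ⟨fun f hf _ x => hasDerivAt_exp_mul_primitive hd hf a _ x, ?_, ?_, ?_⟩
  · intro f hf hi x hx
    refine (hbound f hf hi x hx).trans (sub_le_self _ ?_)
    exact intervalIntegral.integral_nonneg hx fun _ _ => abs_nonneg _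
  · intro f hf hi
    have ht := (intervalIntegral_tendsto_integral_Ioi a hi.abs tendsto_id).const_sub
      (∫ t in Ioi a, |f t|)
    rw [sub_self] at ht
    refine squeeze_zero_norm' ?_ ht
    filter_upwards [Ici_mem_atTop a] with x hx using hbound f hf hi x hx
  · intro f f' hf hf' hi hi' x
    simp only [mul_sub]
    have c1 : Continuous fun t => Real.exp (-∫ s in a..t, d s) * f t := by fun_prop
    have c2 : Continuous fun t => Real.exp (-∫ s in a..t, d s) * f' t := by fun_prop
    rw [intervalIntegral.integral_sub (c1.intervalIntegrable _ _) (c2.intervalIntegrable _ _),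
      integral_sub (hint f hf hi) (hint f' hf' hi')]
    ring

/-- Integrating forward from `a`, the kernel is at most `exp (-δ (x - t))` for `t ≤ x`. It is
bounded by 1 and tends to 0 for each fixed `t`, so dominated convergence gives the limit. -/
lemma isDecayingSolver_of_neg {d : ℝ → ℝ} (hd : Continuous d) {δ : ℝ} (hδ : 0 < δ)
    (h0 : ∀ x, d x ≤ -δ) (a : ℝ) :
    IsDecayingSolver d a fun f x => Real.exp (∫ t in a..x, d t) *
      ((∫ t in a..x, Real.exp (-∫ s in a..t, d s) * f t) - 0) := by
  have hDc := continuous_primitive hd a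
  have hle : ∀ x y, x ≤ y → (∫ t in a..y, d t) - (∫ t in a..x, d t) ≤ -δ * (y - x) := by
    intro x y hxy
    rw [intervalIntegral.integral_interval_sub_left (hd.intervalIntegrable _ _)
      (hd.intervalIntegrable _ _)]
    refine (intervalIntegral.integral_mono_on hxy (hd.intervalIntegrable _ _)
      intervalIntegrable_const fun t _ => h0 t).trans_eq ?_
    rw [intervalIntegral.integral_const, smul_eq_mul, mul_comm]
  have hform : ∀ f : ℝ → ℝ, ∀ x ≥ a, Real.exp (∫ t in a..x, d t) *
      ((∫ t in a..x, Real.exp (-∫ s in a..t, d s) * f t) - 0) =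
      ∫ t in Ioi a, (Ioc a x).indicator
        (fun t => Real.exp ((∫ s in a..x, d s) - ∫ s in a..t, d s) * f t) t := by
    intro f x hx
    rw [sub_zero, setIntegral_indicator measurableSet_Ioc,
      inter_eq_self_of_subset_right Ioc_subset_Ioi_self, ← intervalIntegral.integral_of_le hx,
      ← intervalIntegral.integral_const_mul]
    refine intervalIntegral.integral_congr fun t _ => ?_
    simp only [sub_eq_add_neg, Real.exp_add, mul_assoc]
  have hdom : ∀ (f : ℝ → ℝ) (x t : ℝ), |(Ioc a x).indicator
      (fun t => Real.exp ((∫ s in a..x, d s) - ∫ s in a..t, d s) * f t) t| ≤ |f t| := by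
    intro f x t
    by_cases ht : t ∈ Ioc a x
    · rw [indicator_of_mem ht, abs_mul, Real.abs_exp]
      refine mul_le_of_le_one_left (abs_nonneg _) (Real.exp_le_one_iff.mpr ?_)
      have := hle t x ht.2
      have := mul_nonneg hδ.le (sub_nonneg.mpr ht.2)
      linarith
    · rw [indicator_of_notMem ht, abs_zero]
      exact abs_nonneg _
  refine ⟨fun f hf _ x => hasDerivAt_exp_mul_primitive hd hf a _ x, ?_, ?_, ?_⟩
  · intro f hf hi x hx
    rw [hform f x hx]
    refine (abs_integral_le_integral_abs).trans ?_
    exact integral_mono_of_nonneg (ae_of_all _ fun t => abs_nonneg _) hi.abs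
      (ae_of_all _ fun t => hdom f x t)
  · intro f hf hi
    have key : Tendsto (fun x => ∫ t in Ioi a, (Ioc a x).indicator
        (fun t => Real.exp ((∫ s in a..x, d s) - ∫ s in a..t, d s) * f t) t) atTop
        (𝓝 (∫ t in Ioi a, (0 : ℝ))) := by
      refine tendsto_integral_filter_of_dominated_convergence (fun t => |f t|) ?_ ?_ hi.abs ?_
      · refine Eventually.of_forall fun x => ?_
        have : Continuous fun t => Real.exp ((∫ s in a..x, d s) - ∫ s in a..t, d s) * f t := by
          fun_prop
        exact (this.aestronglyMeasurable).indicator measurableSet_Ioc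
      · exact Eventually.of_forall fun x => ae_of_all _ fun t => hdom f x t
      · refine ae_of_all _ fun t => ?_
        have hz : Tendsto (fun x => Real.exp (-δ * (x - t)) * |f t|) atTop (𝓝 0) := by
          have h1 : Tendsto (fun x => -δ * (x - t)) atTop atBot :=
            (tendsto_atTop_add_const_right atTop (-t) tendsto_id).const_mul_atTop_of_neg
              (by linarith)
          simpa using (Real.tendsto_exp_atBot.comp h1).mul_const |f t|
        refine squeeze_zero_norm' ?_ hz
        filter_upwards [Ici_mem_atTop t] with x hx
        by_cases ht : t ∈ Ioc a x
        · rw [indicator_of_mem ht, norm_mul, Real.norm_of_nonneg (Real.exp_pos _).le]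
          exact mul_le_mul_of_nonneg_right (Real.exp_le_exp.mpr (hle t x hx)) (abs_nonneg _)
        · rw [indicator_of_notMem ht, norm_zero]
          positivity
    rw [integral_zero] at key
    refine key.congr' ?_
    filter_upwards [Ici_mem_atTop a] with x hx using (hform f x hx).symm
  · intro f f' hf hf' hi hi' x
    simp only [mul_sub]
    have c1 : Continuous fun t => Real.exp (-∫ s in a..t, d s) * f t := by fun_prop
    have c2 : Continuous fun t => Real.exp (-∫ s in a..t, d s) * f' t := by fun_prop
    rw [intervalIntegral.integral_sub (c1.intervalIntegrable _ _) (c2.intervalIntegrable _ _)]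
    ring

open scoped BoundedContinuousFunction in
/-- A Levinson-type theorem: an integrable perturbation of a diagonal system keeps the constant
solutions of the diagonal system, up to a term that vanishes at `+∞`. -/
theorem exists_solution_tendsto {ι : Type*} [Fintype ι] {d : ι → ℝ → ℝ}
    (hd : ∀ j, Continuous (d j)) (hsign : ∀ j, (∀ x, 0 ≤ d j x) ∨ ∃ δ > 0, ∀ x, d j x ≤ -δ)
    {A : ℝ → Matrix ι ι ℝ} (hA : Continuous A) {b : ℝ → ℝ} {a : ℝ} (hb : IntegrableOn b (Ioi a))
    (hAb : ∀ x i j, |A x i j| ≤ b x) (ha : Fintype.card ι * ∫ t in Ioi a, b t ≤ 1 / 2)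
    {c : ι → ℝ} (hc : ∀ j, c j = 0 ∨ ∀ x, d j x = 0) :
    ∃ Z : ℝ → ι → ℝ, (∀ x > a, ∀ j,
      HasDerivAt (fun x => Z x j) (d j x * Z x j + (A x).mulVec (Z x) j) x) ∧
      Continuous Z ∧ Tendsto Z atTop (𝓝 c) := by
  have hS : ∀ j, ∃ S, IsDecayingSolver (d j) a S := fun j => by
    rcases hsign j with h | ⟨δ, hδ, h⟩
    · exact ⟨_, isDecayingSolver_of_nonneg (hd j) h a⟩
    · exact ⟨_, isDecayingSolver_of_neg (hd j) hδ h a⟩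
  choose S hS using hS
  have hfc : ∀ (Z : ℝ →ᵇ (ι → ℝ)) j, Continuous fun t => (A t).mulVec (Z t) j := fun Z j =>
    (continuous_apply j).comp (hA.matrix_mulVec Z.continuous)
  have hfb : ∀ (Z : ℝ →ᵇ (ι → ℝ)) j t, |(A t).mulVec (Z t) j| ≤
      (Fintype.card ι * ‖Z‖) * b t := fun Z j t => by
    refine (abs_mulVec_le (hAb t) (Z t) j).trans ?_
    have hb0 : 0 ≤ b t := (abs_nonneg _).trans (hAb t j j)
    have := mul_le_mul_of_nonneg_left (Z.norm_coe_le_norm t)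
      (mul_nonneg (Nat.cast_nonneg (α := ℝ) (Fintype.card ι)) hb0)
    linarith
  have hfi : ∀ (Z : ℝ →ᵇ (ι → ℝ)) j, IntegrableOn (fun t => (A t).mulVec (Z t) j) (Ioi a) :=
    fun Z j => Integrable.mono' (hb.const_mul _) (hfc Z j).aestronglyMeasurable
      (ae_of_all _ fun t => hfb Z j t)
  have hfint : ∀ (Z : ℝ →ᵇ (ι → ℝ)) j, ∫ t in Ioi a, |(A t).mulVec (Z t) j| ≤ 1 / 2 * ‖Z‖ := by
    intro Z j
    refine (integral_mono (hfi Z j).abs (hb.const_mul _) (fun t => hfb Z j t)).trans ?_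
    rw [integral_const_mul]
    have := mul_le_mul_of_nonneg_right ha (norm_nonneg Z)
    linarith
  have hSc : ∀ (Z : ℝ →ᵇ (ι → ℝ)) j, Continuous (S j fun t => (A t).mulVec (Z t) j) :=
    fun Z j => continuous_iff_continuousAt.mpr fun x =>
      ((hS j).hasDerivAt _ (hfc Z j) (hfi Z j) x).continuousAt
  have hSb : ∀ (Z : ℝ →ᵇ (ι → ℝ)) j x, |S j (fun t => (A t).mulVec (Z t) j) (max x a)| ≤
      1 / 2 * ‖Z‖ := fun Z j x =>
    ((hS j).abs_le _ (hfc Z j) (hfi Z j) _ (le_max_right _ _)).trans (hfint Z j)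
  -- The integral equation `Z = c + S (A Z)`. The solver is controlled only on `[a, ∞)`, so its
  -- output is frozen to the left of `a` to remain bounded on the line.
  let T : (ℝ →ᵇ (ι → ℝ)) → (ℝ →ᵇ (ι → ℝ)) := fun Z =>
    BoundedContinuousFunction.ofNormedAddCommGroup
      (fun x j => c j + S j (fun t => (A t).mulVec (Z t) j) (max x a))
      (continuous_pi fun j => continuous_const.add ((hSc Z j).comp (by fun_prop)))
      (‖c‖ + 1 / 2 * ‖Z‖) (fun x => (pi_norm_le_iff_of_nonneg (by positivity)).mpr fun j =>
        (norm_add_le _ _).trans (add_le_add (norm_le_pi_norm c j) (hSb Z j x)))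
  -- By linearity of the solver the difference of two images is bounded by `card ι * ∫ b` times the
  -- distance, and `ha` bounds that factor by 1/2.
  have hT : ContractingWith (1 / 2) T := by
    refine ⟨by norm_num, LipschitzWith.of_dist_le_mul fun Z Z' => ?_⟩
    rw [BoundedContinuousFunction.dist_le (by positivity)]
    intro x
    rw [dist_pi_le_iff (by positivity)]
    intro j
    have e : S j (fun t => (A t).mulVec ((Z - Z') t) j) (max x a) =
        S j (fun t => (A t).mulVec (Z t) j) (max x a) -
          S j (fun t => (A t).mulVec (Z' t) j) (max x a) := by
      rw [← (hS j).sub _ _ (hfc Z j) (hfc Z' j) (hfi Z j) (hfi Z' j)]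
      simp [Matrix.mulVec_sub]
    have := hSb (Z - Z') j x
    rw [e] at this
    simpa [T, Real.dist_eq, dist_eq_norm] using this
  obtain ⟨Z, hZ⟩ : ∃ Z, T Z = Z := ⟨_, hT.fixedPoint_isFixedPt⟩
  have hZj : ∀ x j, Z x j = c j + S j (fun t => (A t).mulVec (Z t) j) (max x a) := fun x j => by
    conv_lhs => rw [← hZ]
    rfl
  have hZa : ∀ j, ∀ x ≥ a, Z x j = c j + S j (fun t => (A t).mulVec (Z t) j) x := fun j x hx => by
    rw [hZj, max_eq_left hx]
  refine ⟨Z, fun x hx j => ?_, Z.continuous, ?_⟩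
  · have h1 := ((hS j).hasDerivAt _ (hfc Z j) (hfi Z j) x).const_add (c j)
    have h2 : HasDerivAt (fun x => Z x j) (d j x * S j (fun t => (A t).mulVec (Z t) j) x +
        (A x).mulVec (Z x) j) x := by
      refine h1.congr_of_eventuallyEq ?_
      filter_upwards [Ici_mem_nhds hx] with y hy using hZa j y hy
    refine h2.congr_deriv ?_
    rw [hZa j x (le_of_lt hx)]
    -- The constant `c j` adds `d j x * c j` to the right-hand side; it vanishes in both cases of
    -- `hc`.
    rcases hc j with h | h
    · rw [h, zero_add]
    · rw [h]; ring
  · rw [tendsto_pi_nhds]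
    intro j
    have := ((hS j).tendsto _ (hfc Z j) (hfi Z j)).const_add (c j)
    rw [add_zero] at this
    refine this.congr' ?_
    filter_upwards [Ici_mem_atTop a] with x hx using (hZa j x hx).symm

end Levinson

/-! ### Diagonalizing coordinates for the first-order system -/

section Existence

variable {g k mu lam : ℝ} {ρ₀ : ℝ → ℝ}

/-- The matrix of the perturbation of the diagonal system, per unit of `ρ₀'`. In the application
`α = lam / mu`, `β = g k² / (lam mu)`, `s = mu / (lam r)`, `s₁ = ds/dr`, `q = 1 / (2 σ)` and
`τ = (dσ/dr) / (2 σ)`. -/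
def perturbation (α β k s s₁ q τ : ℝ) : Matrix (Fin 4) (Fin 4) ℝ :=
  !![-s * (α / 2 + β / (2 * k)), -s * (α / 2 - β / (2 * k)),
      -s₁ * (1 / 2 + k * q) - s * (s * (α / 2 + β * q)),
      -s₁ * (1 / 2 - k * q) - s * (s * (α / 2 - β * q));
    -s * (α / 2 + β / (2 * k)), -s * (α / 2 - β / (2 * k)),
      -s₁ * (1 / 2 - k * q) - s * (s * (α / 2 + β * q)),
      -s₁ * (1 / 2 + k * q) - s * (s * (α / 2 - β * q));
    α / 2 + β / (2 * k), α / 2 - β / (2 * k), s * (α / 2 + β * q) + τ, s * (α / 2 - β * q) - τ;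
    α / 2 + β / (2 * k), α / 2 - β / (2 * k), s * (α / 2 + β * q) - τ, s * (α / 2 - β * q) + τ]

/-- The vector `(φ, φ', φ'', φ''')` in terms of the coordinates that diagonalize the system. -/
def recompose (k s q : ℝ) (Z : Fin 4 → ℝ) : Fin 4 → ℝ :=
  ![(Z 0 - Z 1) / (2 * k) + s * ((Z 2 - Z 3) * q),
    (Z 0 + Z 1) / 2 + s * ((Z 2 + Z 3) / 2),
    k ^ 2 * ((Z 0 - Z 1) / (2 * k) + s * ((Z 2 - Z 3) * q)) + (Z 2 - Z 3) * q,
    k ^ 2 * ((Z 0 + Z 1) / 2 + s * ((Z 2 + Z 3) / 2)) + (Z 2 + Z 3) / 2]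

/-- The perturbation at a density `r`. -/
def perturbationAt (g k mu lam r : ℝ) : Matrix (Fin 4) (Fin 4) ℝ :=
  perturbation (lam / mu) (g * k ^ 2 / (lam * mu)) k (mu / (lam * r)) (-(mu / (lam * r ^ 2)))
    (1 / (2 * sigma k mu lam r)) (lam / (4 * mu * sigma k mu lam r ^ 2))

/-- The change of coordinates at a density `r`. -/
def recomposeAt (k mu lam r : ℝ) (Z : Fin 4 → ℝ) : Fin 4 → ℝ :=
  recompose k (mu / (lam * r)) (1 / (2 * sigma k mu lam r)) Z

/-- The eigenvalues of the leading matrix at a density `r`. -/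
def eigenvalue (k mu lam r : ℝ) : Fin 4 → ℝ := ![k, -k, sigma k mu lam r, -sigma k mu lam r]

lemma sq_sigma (hmu : 0 < mu) (hlam : 0 < lam) {r : ℝ} (hr : 0 < r) :
    sigma k mu lam r ^ 2 = k ^ 2 + lam / mu * r := Real.sq_sqrt (by positivity)

lemma sigma_pos (hmu : 0 < mu) (hlam : 0 < lam) {r : ℝ} (hr : 0 < r) :
    0 < sigma k mu lam r := Real.sqrt_pos.mpr (by positivity)

lemma hasDerivAt_sigma (hmu : 0 < mu) (hlam : 0 < lam) (hρ : ContDiff ℝ 1 ρ₀)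
    (hpos : ∀ x, 0 < ρ₀ x) (x : ℝ) :
    HasDerivAt (fun x => sigma k mu lam (ρ₀ x))
      (lam / mu * deriv ρ₀ x / (2 * sigma k mu lam (ρ₀ x))) x := by
  have hr := ((hρ.differentiable (by norm_num)) x).hasDerivAt
  have h0 : k ^ 2 + lam / mu * ρ₀ x ≠ 0 := by
    have := hpos x
    positivity
  exact ((hr.const_mul (lam / mu)).const_add (k ^ 2)).sqrt h0

/-- At a frozen density the leading operator factors as `(D² - σ²)(D² - k²)`. Up to the factor `exp
θ`, `v = φ'' - k² φ` and `z = φ''' - k² φ'` carry the exponents `±σ`, while `u = φ - s v` and `w =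
φ' - s z` carry `±k`. Variation of the density contributes only terms with the factor `ρ₀'`, which
make up the perturbation. The function `θ` with derivative `l` shifts all exponents by `l`. -/
theorem isSystemSolution_recompose (hk : 0 < k) (hmu : 0 < mu) (hlam : 0 < lam)
    (hρ : ContDiff ℝ 1 ρ₀) (hpos : ∀ x, 0 < ρ₀ x) {I : Set ℝ} {θ l : ℝ → ℝ}
    (hθ : ∀ x, HasDerivAt θ (l x) x) {Z : ℝ → Fin 4 → ℝ}
    (hZ : ∀ x ∈ I, ∀ j, HasDerivAt (fun x => Z x j)
      ((eigenvalue k mu lam (ρ₀ x) j - l x) * Z x j +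
        (deriv ρ₀ x • perturbationAt g k mu lam (ρ₀ x)).mulVec (Z x) j) x) :
    IsSystemSolution g k mu lam ρ₀ I
      (fun x => Real.exp (θ x) • recomposeAt k mu lam (ρ₀ x) (Z x)) := by
  refine isSystemSolution_iff.mpr fun x hx => ?_
  have z0 := hZ x hx 0
  have z1 := hZ x hx 1
  have z2 := hZ x hx 2
  have z3 := hZ x hx 3
  have hr := ((hρ.differentiable (by norm_num)) x).hasDerivAt
  have hr0 := hpos x
  have hs0 := sigma_pos (k := k) hmu hlam hr0
  have hsq := sq_sigma (k := k) hmu hlam hr0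
  have hS := hasDerivAt_sigma (k := k) hmu hlam hρ hpos x
  have hs : HasDerivAt (fun x => mu / (lam * ρ₀ x))
      (-(mu / (lam * ρ₀ x ^ 2)) * deriv ρ₀ x) x := by
    refine ((hasDerivAt_const x mu).div (hr.const_mul lam) (by positivity)).congr_deriv ?_
    field_simp
    ring
  have hE := (hθ x).exp
  simp only [eigenvalue, perturbationAt, perturbation, Matrix.mulVec, dotProduct,
    Fin.sum_univ_four, Matrix.smul_apply, Matrix.of_apply, Matrix.cons_val', Matrix.cons_val,
    Matrix.cons_val_fin_one, smul_eq_mul, Fin.isValue] at z0 z1 z2 z3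
  set r := ρ₀ x with hrdef
  set r' := deriv ρ₀ x with hr'def
  set σ := sigma k mu lam r with hσ
  set L := l x with hL
  set s := mu / (lam * r) with hsdef
  set u := (Z x 0 - Z x 1) / (2 * k) with hu
  set w := (Z x 0 + Z x 1) / 2 with hw
  set v := (Z x 2 - Z x 3) * (1 / (2 * σ)) with hv
  set z := (Z x 2 + Z x 3) / 2 with hz
  set s₁ := -(mu / (lam * r ^ 2)) with hs₁
  -- `r' * F` is the contribution of the matrix `matR` to the last equation, since `w + s * z` and
  -- `u + s * v` are the rescaled `φ'` and `φ`.
  set F := lam / mu * (w + s * z) + g * k ^ 2 / (lam * mu) * (u + s * v) with hF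
  have Du : HasDerivAt (fun x => (Z x 0 - Z x 1) / (2 * k)) (w - L * u - s₁ * r' * v) x := by
    refine ((z0.sub z1).div_const (2 * k)).congr_deriv ?_
    rw [hu, hw, hv]
    field_simp
    ring
  have Dw : HasDerivAt (fun x => (Z x 0 + Z x 1) / 2)
      (k ^ 2 * u - L * w - s₁ * r' * z - s * r' * F) x := by
    refine ((z0.add z1).div_const 2).congr_deriv ?_
    rw [hF, hu, hw, hv, hz]
    field_simp
    ring
  have Dv : HasDerivAt (fun x => (Z x 2 - Z x 3) * (1 / (2 * sigma k mu lam (ρ₀ x))))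
      (z - L * v) x := by
    refine ((z2.sub z3).mul ((hasDerivAt_const x (1 : ℝ)).div (hS.const_mul 2)
      (by positivity))).congr_deriv ?_
    simp only [Pi.sub_apply, Pi.div_apply, ← hσ, ← hrdef]
    rw [hv, hz]
    field_simp
    ring
  have Dz : HasDerivAt (fun x => (Z x 2 + Z x 3) / 2) (σ ^ 2 * v - L * z + r' * F) x := by
    refine ((z2.add z3).div_const 2).congr_deriv ?_
    rw [hF, hu, hw, hv, hz]
    field_simp
    ring
  -- The relation `s (σ² - k²) = 1`, which is what makes `φ - s v` lie in the kernel of `D² - k²` at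
  -- constant density.
  have hss : s * σ ^ 2 = s * k ^ 2 + 1 := by
    rw [hsq, hsdef]
    field_simp
  have D0 := Du.add (hs.mul Dv)
  have D1 := Dw.add (hs.mul Dz)
  refine ⟨?_, ?_, ?_, ?_⟩
  · refine (hE.mul D0).congr_deriv ?_
    simp only [recomposeAt, recompose, Pi.add_apply, Pi.mul_apply, Pi.smul_apply, smul_eq_mul,
      Matrix.cons_val, ← hrdef, ← hσ, ← hu, ← hv, ← hw, ← hz, ← hsdef]
    ring
  · refine (hE.mul D1).congr_deriv ?_
    simp only [recomposeAt, recompose, Pi.add_apply, Pi.mul_apply, Pi.smul_apply, smul_eq_mul,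
      Matrix.cons_val, ← hrdef, ← hσ, ← hu, ← hv, ← hw, ← hz, ← hsdef]
    linear_combination Real.exp (θ x) * v * hss
  · refine (hE.mul ((D0.const_mul (k ^ 2)).add Dv)).congr_deriv ?_
    simp only [recomposeAt, recompose, Pi.add_apply, Pi.mul_apply, Pi.smul_apply, smul_eq_mul,
      Matrix.cons_val, ← hrdef, ← hσ, ← hu, ← hv, ← hw, ← hz, ← hsdef]
    ring
  · refine (hE.mul ((D1.const_mul (k ^ 2)).add Dz)).congr_deriv ?_
    simp only [recomposeAt, recompose, fourthDeriv, Pi.add_apply, Pi.mul_apply, Pi.smul_apply,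
      smul_eq_mul, Matrix.cons_val, ← hrdef, ← hr'def, ← hσ, ← hu, ← hv, ← hw, ← hz,
      ← hsdef]
    have e : lam * r / mu = σ ^ 2 - k ^ 2 := by rw [hsq]; ring
    have e2 : lam * k ^ 2 * r / mu = k ^ 2 * (σ ^ 2 - k ^ 2) := by rw [hsq]; ring
    rw [e, e2, hF]
    linear_combination k ^ 2 * Real.exp (θ x) * v * hss

lemma continuousOn_perturbationAt (hmu : 0 < mu) (hlam : 0 < lam) (i j : Fin 4) :
    ContinuousOn (fun r => perturbationAt g k mu lam r i j) (Ioi 0) := by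
  have hsig : ContinuousOn (fun r => sigma k mu lam r) (Ioi 0) :=
    (continuous_sigma continuous_id).continuousOn
  have c1 : ContinuousOn (fun r => mu / (lam * r)) (Ioi 0) :=
    continuousOn_const.div (by fun_prop) fun r hr => (mul_pos hlam hr).ne'
  have c2 : ContinuousOn (fun r => -(mu / (lam * r ^ 2))) (Ioi 0) :=
    (continuousOn_const.div (by fun_prop) fun r hr => (mul_pos hlam (pow_pos hr 2)).ne').neg
  have c3 : ContinuousOn (fun r => 1 / (2 * sigma k mu lam r)) (Ioi 0) :=
    continuousOn_const.div (by fun_prop) fun r hr =>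
      (mul_pos two_pos (sigma_pos hmu hlam hr)).ne'
  have c4 : ContinuousOn (fun r => lam / (4 * mu * sigma k mu lam r ^ 2)) (Ioi 0) :=
    continuousOn_const.div (by fun_prop) fun r hr =>
      (mul_pos (by positivity) (pow_pos (sigma_pos hmu hlam hr) 2)).ne'
  have key : Continuous fun p : ℝ × ℝ × ℝ × ℝ =>
      perturbation (lam / mu) (g * k ^ 2 / (lam * mu)) k p.1 p.2.1 p.2.2.1 p.2.2.2 i j := by
    fin_cases i <;> fin_cases j <;> simp [perturbation] <;> fun_prop
  exact key.comp_continuousOn (c1.prodMk (c2.prodMk (c3.prodMk c4)))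

lemma continuousOn_recomposeAt (hmu : 0 < mu) (hlam : 0 < lam) :
    ContinuousOn (fun p : ℝ × (Fin 4 → ℝ) => recomposeAt k mu lam p.1 p.2) {p | 0 < p.1} := by
  have c1 : ContinuousOn (fun p : ℝ × (Fin 4 → ℝ) => mu / (lam * p.1)) {p | 0 < p.1} :=
    continuousOn_const.div (by fun_prop) fun p hp => (mul_pos hlam hp).ne'
  have c3 : ContinuousOn (fun p : ℝ × (Fin 4 → ℝ) => 1 / (2 * sigma k mu lam p.1))
      {p | 0 < p.1} :=
    continuousOn_const.div
      (continuousOn_const.mul ((continuous_sigma continuous_id).comp continuous_fst).continuousOn)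
      fun p hp => (mul_pos two_pos (sigma_pos hmu hlam hp)).ne'
  have key : Continuous fun p : ℝ × ℝ × (Fin 4 → ℝ) => recompose k p.1 p.2.1 p.2.2 := by
    refine continuous_pi fun j => ?_
    fin_cases j <;> simp [recompose] <;> fun_prop
  exact key.comp_continuousOn (c1.prodMk (c3.prodMk continuousOn_snd))

end Existence

/-! ### Construction of the decaying pair at infinity -/

section ExistenceOfDecayingPairs

variable {g k mu lam : ℝ} {ρ₀ : ℝ → ℝ}

lemma exists_setIntegral_Ioi_le {f : ℝ → ℝ} {a₀ : ℝ} (hf : IntegrableOn f (Ioi a₀)) {ε : ℝ}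
    (hε : 0 < ε) : ∃ a₁ ≥ a₀, ∀ a ≥ a₁, ∫ t in Ioi a, f t ≤ ε := by
  have ht := (intervalIntegral_tendsto_integral_Ioi a₀ hf tendsto_id).const_sub
    (∫ t in Ioi a₀, f t)
  rw [sub_self] at ht
  obtain ⟨a₁, h⟩ := eventually_atTop.mp (ht.eventually_le_const hε)
  refine ⟨max a₀ a₁, le_max_left _ _, fun a ha => ?_⟩
  have h1 := h a ((le_max_right _ _).trans ha)
  rwa [id_eq, ← intervalIntegral.integral_Ioi_sub_Ioi hf ((le_max_left _ _).trans ha),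
    sub_sub_cancel] at h1

lemma exists_norm_le_of_tendsto {E : Type*} [NormedAddCommGroup E] {f : ℝ → E}
    (hf : Continuous f) {v : E} (h : Tendsto f atTop (𝓝 v)) (a : ℝ) :
    ∃ C, ∀ x ≥ a, ‖f x‖ ≤ C := by
  obtain ⟨x₁, h₁⟩ := eventually_atTop.mp
    (h.norm.eventually_le_const (lt_add_one ‖v‖))
  obtain ⟨C, hC⟩ := (isCompact_Icc (a := a) (b := x₁)).exists_bound_of_continuousOn hf.continuousOn
  refine ⟨max C (‖v‖ + 1), fun x hx => ?_⟩
  rcases le_total x x₁ with hx' | hx'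
  · exact (hC x ⟨hx, hx'⟩).trans (le_max_left _ _)
  · exact (h₁ x hx').trans (le_max_right _ _)

/-- Solutions with a prescribed exponential behaviour at `+∞`. -/
lemma exists_solution_exp_tendsto (hk : 0 < k) (hmu : 0 < mu) (hlam : 0 < lam)
    (hρ : ContDiff ℝ 1 ρ₀) (hpos : ∀ x, 0 < ρ₀ x) {ρp : ℝ} (hρp : 0 < ρp)
    (hlim : Tendsto ρ₀ atTop (𝓝 ρp)) {b : ℝ → ℝ} {a : ℝ} (hb : IntegrableOn b (Ioi a))
    (hAb : ∀ x i j, |(deriv ρ₀ x • perturbationAt g k mu lam (ρ₀ x)) i j| ≤ b x)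
    (ha : 4 * ∫ t in Ioi a, b t ≤ 1 / 2) {θ l : ℝ → ℝ} (hθ : ∀ x, HasDerivAt θ (l x) x)
    (hθb : ∃ C, ∀ x > a, θ x ≤ C) (hl : Continuous l)
    (hsign : ∀ j, (∀ x, 0 ≤ eigenvalue k mu lam (ρ₀ x) j - l x) ∨
      ∃ δ > 0, ∀ x, eigenvalue k mu lam (ρ₀ x) j - l x ≤ -δ) {c : Fin 4 → ℝ}
    (hc : ∀ j, c j = 0 ∨ ∀ x, eigenvalue k mu lam (ρ₀ x) j - l x = 0) :
    ∃ U : ℝ → Fin 4 → ℝ, IsBoundedSystemSolution g k mu lam ρ₀ (Ioi a) U ∧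
      Tendsto (fun x => Real.exp (-θ x) • U x) atTop (𝓝 (recomposeAt k mu lam ρp c)) := by
  have hsig := continuous_sigma (k := k) (mu := mu) (lam := lam) hρ.continuous
  have hd : ∀ j, Continuous fun x => eigenvalue k mu lam (ρ₀ x) j - l x := by
    intro j
    fin_cases j <;> simp [eigenvalue] <;> fun_prop
  have hA : Continuous fun x => deriv ρ₀ x • perturbationAt g k mu lam (ρ₀ x) := by
    refine (hρ.continuous_deriv le_rfl).smul (continuous_matrix fun i j => ?_)
    exact (continuousOn_perturbationAt hmu hlam i j).comp_continuous hρ.continuous hpos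
  obtain ⟨Z, hZ, hZc, hZt⟩ := exists_solution_tendsto hd hsign hA hb hAb
    (by simpa using ha) hc
  have hR := continuousOn_recomposeAt (k := k) hmu hlam
  have hPc : Continuous fun x => recomposeAt k mu lam (ρ₀ x) (Z x) :=
    hR.comp_continuous (hρ.continuous.prodMk hZc) hpos
  have hPt : Tendsto (fun x => recomposeAt k mu lam (ρ₀ x) (Z x)) atTop
      (𝓝 (recomposeAt k mu lam ρp c)) := by
    have hopen : IsOpen {p : ℝ × (Fin 4 → ℝ) | 0 < p.1} := isOpen_lt continuous_const continuous_fst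
    have hat : ContinuousAt (fun p : ℝ × (Fin 4 → ℝ) => recomposeAt k mu lam p.1 p.2) (ρp, c) :=
      hR.continuousAt (hopen.mem_nhds hρp)
    exact Tendsto.comp (f := fun x => (ρ₀ x, Z x))
      (g := fun p : ℝ × (Fin 4 → ℝ) => recomposeAt k mu lam p.1 p.2) hat (hlim.prodMk_nhds hZt)
  refine ⟨_, ⟨isSystemSolution_recompose hk hmu hlam hρ hpos hθ fun x hx j => hZ x hx j, ?_⟩, ?_⟩
  · obtain ⟨C, hC⟩ := hθb
    obtain ⟨C', hC'⟩ := exists_norm_le_of_tendsto hPc hPt a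
    refine ⟨Real.exp C * C', fun x hx => ?_⟩
    rw [norm_smul, Real.norm_of_nonneg (Real.exp_pos _).le]
    exact mul_le_mul (Real.exp_le_exp.mpr (hC x hx)) (hC' x (le_of_lt hx)) (norm_nonneg _)
      (Real.exp_pos _).le
  · refine hPt.congr fun x => ?_
    rw [smul_smul, ← Real.exp_add]
    simp

theorem exists_isDecayingPairAtTop (g : ℝ) (hk : 0 < k) (hmu : 0 < mu) (hlam : 0 < lam)
    (hρ : ContDiff ℝ 1 ρ₀) {r₀ r₁ ρp : ℝ} (hr₀ : 0 < r₀) (hle : ∀ x, r₀ ≤ ρ₀ x)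
    (hge : ∀ x, ρ₀ x ≤ r₁) (hρp : 0 < ρp) (hlim : Tendsto ρ₀ atTop (𝓝 ρp))
    (hint : IntegrableOn (deriv ρ₀) (Ioi 0)) :
    ∃ a ≥ 1, ∃ U V : ℝ → Fin 4 → ℝ, IsDecayingPairAtTop g k mu lam ρ₀ ρp a U V := by
  have hpos : ∀ x, 0 < ρ₀ x := fun x => hr₀.trans_le (hle x)
  have hsig := continuous_sigma (k := k) (mu := mu) (lam := lam) hρ.continuous
  have hbd : ∃ C, ∀ x i j, |perturbationAt g k mu lam (ρ₀ x) i j| ≤ C := by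
    have : ∀ p : Fin 4 × Fin 4, ∃ C, ∀ r ∈ Icc r₀ r₁,
        ‖perturbationAt g k mu lam r p.1 p.2‖ ≤ C := fun p =>
      isCompact_Icc.exists_bound_of_continuousOn
        ((continuousOn_perturbationAt hmu hlam p.1 p.2).mono fun r hr => hr₀.trans_le hr.1)
    choose C hC using this
    refine ⟨∑ p, |C p|, fun x i j => ?_⟩
    refine (hC (i, j) _ ⟨hle x, hge x⟩).trans ((le_abs_self _).trans ?_)
    exact Finset.single_le_sum (f := fun p => |C p|) (fun _ _ => abs_nonneg _)
      (Finset.mem_univ (i, j))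
  obtain ⟨C, hC⟩ := hbd
  have hb0 : IntegrableOn (fun x => C * |deriv ρ₀ x|) (Ioi 0) := hint.abs.const_mul C
  -- Four coordinates times 1/8 give the bound 1/2 required for the contraction.
  obtain ⟨a₁, ha₁, hsmall⟩ := exists_setIntegral_Ioi_le hb0 (ε := 1 / 8) (by norm_num)
  -- A starting point of at least 1 ensures, after reflection, that the left and right half lines
  -- are disjoint.
  set a := max a₁ 1 with ha
  have hb : IntegrableOn (fun x => C * |deriv ρ₀ x|) (Ioi a) :=
    hb0.mono_set (Ioi_subset_Ioi (ha₁.trans (le_max_left _ _)))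
  have hAb : ∀ x i j, |(deriv ρ₀ x • perturbationAt g k mu lam (ρ₀ x)) i j| ≤
      C * |deriv ρ₀ x| := fun x i j => by
    rw [Matrix.smul_apply, smul_eq_mul, abs_mul, mul_comm]
    exact mul_le_mul_of_nonneg_right (hC x i j) (abs_nonneg _)
  have hI : 4 * ∫ t in Ioi a, C * |deriv ρ₀ t| ≤ 1 / 2 := by
    linarith [hsmall a (le_max_left _ _)]
  have hks : ∀ x, k < sigma k mu lam (ρ₀ x) := fun x => lt_sigma hmu hlam (hpos x)
  have hs0 := sigma_pos (k := k) hmu hlam hρp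
  have hss := sq_sigma (k := k) hmu hlam hρp
  -- With the exponent `-k` removed, the differences are `2k`, `0`, `σ + k` and `k - σ`. The entry
  -- `2 / k²` normalizes the last component of the limit to 1.
  obtain ⟨U, hU, tU⟩ := exists_solution_exp_tendsto (θ := fun x => -k * x) (l := fun _ => -k)
    (c := ![0, 2 / k ^ 2, 0, 0]) hk hmu hlam hρ hpos hρp hlim hb hAb hI
    (fun x => by simpa using (hasDerivAt_id x).const_mul (-k))
    ⟨-k * a, fun x hx => by nlinarith⟩ continuous_const
    (fun j => by
      fin_cases j
      · exact Or.inl fun x => by simp [eigenvalue]; linarith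
      · exact Or.inl fun x => by simp [eigenvalue]
      · exact Or.inl fun x => by simp [eigenvalue]; linarith [hks x]
      -- The only negative difference is `k - σ`; it stays away from 0 because `σ` increases with
      -- the density and `ρ₀ ≥ r₀`.
      · refine Or.inr ⟨sigma k mu lam r₀ - k, sub_pos.mpr (lt_sigma hmu hlam hr₀), fun x => ?_⟩
        have : sigma k mu lam r₀ ≤ sigma k mu lam (ρ₀ x) := by
          refine Real.sqrt_le_sqrt ?_
          have := mul_le_mul_of_nonneg_left (hle x) (div_pos hlam hmu).le
          linarith
        simp [eigenvalue]
        linarith)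
    (fun j => by fin_cases j <;> simp [eigenvalue])
  -- With the variable exponent `-σ₀` removed, all differences are nonnegative. The last entry of
  -- `c` equals `2 (σ² - k²) / σ²`, which again normalizes the last component of the limit to 1.
  obtain ⟨V, hV, tV⟩ := exists_solution_exp_tendsto
    (θ := fun x => -∫ y in a..x, sigma k mu lam (ρ₀ y)) (l := fun x => -sigma k mu lam (ρ₀ x))
    (c := ![0, 0, 0, 2 * lam * ρp / (mu * sigma k mu lam ρp ^ 2)])
    hk hmu hlam hρ hpos hρp hlim hb hAb hI
    (fun x => (hsig.integral_hasStrictDerivAt a x).hasDerivAt.fun_neg)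
    ⟨0, fun x hx => neg_nonpos.mpr
      (intervalIntegral.integral_nonneg (le_of_lt hx) fun y _ => (hk.trans (hks y)).le)⟩ hsig.neg
    (fun j => by
      refine Or.inl fun x => ?_
      have := hks x
      fin_cases j <;> simp [eigenvalue] <;> linarith)
    (fun j => by fin_cases j <;> simp [eigenvalue])
  refine ⟨a, le_max_right _ _, U, V, hU, hV, ?_, ?_⟩
  · refine (tU.congr fun x => by simp).trans (le_of_eq ?_)
    congr 1
    ext j
    fin_cases j <;> simp [recomposeAt, recompose] <;> field_simp
  · refine (tV.congr fun x => by simp).trans (le_of_eq ?_)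
    congr 1
    set σ := sigma k mu lam ρp with hσ
    have e : lam * ρp = mu * (σ ^ 2 - k ^ 2) := by rw [hss]; field_simp; ring
    have e' : σ ^ 2 - k ^ 2 ≠ 0 := by rw [hss]; ring_nf; positivity
    ext j
    fin_cases j <;> simp [recomposeAt, recompose, mul_assoc, e, ← hσ] <;> field_simp <;> ring

end ExistenceOfDecayingPairs

/-! ### Bounds for the density profile and integrability of its derivative -/

section Profile

variable {ρ₀ : ℝ → ℝ} {ρm ρp : ℝ}

lemma IsIncreasingProfile.monotone (h : IsIncreasingProfile ρ₀ ρm ρp) : Monotone ρ₀ := by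
  obtain ⟨M, hM⟩ := h.deriv_bounds
  exact monotone_of_deriv_nonneg (h.contDiff.differentiable (by norm_num)) fun x => (hM x).1.le

lemma IsIncreasingProfile.left_le (h : IsIncreasingProfile ρ₀ ρm ρp) (x : ℝ) : ρm ≤ ρ₀ x :=
  h.monotone.le_of_tendsto h.tendsto_atBot x

lemma IsIncreasingProfile.le_right (h : IsIncreasingProfile ρ₀ ρm ρp) (x : ℝ) : ρ₀ x ≤ ρp :=
  h.monotone.ge_of_tendsto h.tendsto_atTop x

lemma IsIncreasingProfile.pos (h : IsIncreasingProfile ρ₀ ρm ρp) (x : ℝ) : 0 < ρ₀ x :=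
  h.left_pos.trans_le (h.left_le x)

lemma IsIncreasingProfile.abs_le (h : IsIncreasingProfile ρ₀ ρm ρp) (x : ℝ) : |ρ₀ x| ≤ ρp := by
  rw [abs_of_pos (h.pos x)]
  exact h.le_right x

lemma IsIncreasingProfile.exists_abs_deriv_le (h : IsIncreasingProfile ρ₀ ρm ρp) :
    ∃ M, ∀ x, |deriv ρ₀ x| ≤ M := by
  obtain ⟨M, hM⟩ := h.deriv_bounds
  exact ⟨M, fun x => by rw [abs_of_pos (hM x).1]; exact (hM x).2.le⟩

/-- A derivative of constant sign is integrable once the function has a finite limit. This is the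
smallness at infinity that the asymptotic integration needs. -/
lemma IsIncreasingProfile.integrableOn_deriv (h : IsIncreasingProfile ρ₀ ρm ρp) :
    IntegrableOn (deriv ρ₀) (Ioi 0) := by
  obtain ⟨M, hM⟩ := h.deriv_bounds
  exact integrableOn_Ioi_deriv_of_nonneg'
    (fun x _ => (h.contDiff.differentiable (by norm_num) x).hasDerivAt) (fun x _ => (hM x).1.le)
    h.tendsto_atTop

lemma IsIncreasingProfile.integrableOn_deriv_neg (h : IsIncreasingProfile ρ₀ ρm ρp) :
    IntegrableOn (deriv fun x => ρ₀ (-x)) (Ioi 0) := by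
  obtain ⟨M, hM⟩ := h.deriv_bounds
  have hc : ContDiff ℝ 1 fun x => ρ₀ (-x) := h.contDiff.comp contDiff_neg
  refine integrableOn_Ioi_deriv_of_nonpos'
    (fun x _ => (hc.differentiable (by norm_num) x).hasDerivAt) (fun x _ => ?_)
    (h.tendsto_atBot.comp tendsto_neg_atTop_atBot)
  have : deriv (fun x => ρ₀ (-x)) x = -deriv ρ₀ (-x) := deriv_comp_neg ρ₀ x
  rw [this]
  exact neg_nonpos.mpr (hM (-x)).1.le

end Profile

/-! ### Boundary coefficients attached to a decaying pair -/

section BoundaryMatrices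

variable {g k mu lam ρp ρm a : ℝ} {ρ₀ : ℝ → ℝ} {I : Set ℝ} {U V : ℝ → Fin 4 → ℝ}

/-- `U, V` are square integrable solutions on `I` spanning all such solutions, and `n x` describes
the plane that they span at `x`. -/
structure IsSpanningPair (g k mu lam : ℝ) (ρ₀ : ℝ → ℝ) (I : Set ℝ) (U V : ℝ → Fin 4 → ℝ)
    (n : ℝ → Matrix (Fin 2) (Fin 2) ℝ) : Prop where
  left_solution : IsSystemSolution g k mu lam ρ₀ I U
  right_solution : IsSystemSolution g k mu lam ρ₀ I V
  left_memLp : ∀ j, MemLp (fun x => U x j) 2 (volume.restrict I)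
  right_memLp : ∀ j, MemLp (fun x => V x j) 2 (volume.restrict I)
  boundaryRelation_iff : ∀ x ∈ I, ∀ w : Fin 4 → ℝ,
    BoundaryRelation (n x) w ↔ w ∈ Submodule.span ℝ {U x, V x}
  exists_combination : ∀ W : ℝ → Fin 4 → ℝ, IsSystemSolution g k mu lam ρ₀ I W →
    (∀ j, MemLp (fun x => W x j) 2 (volume.restrict I)) →
    ∃ c d : ℝ, ∀ y ∈ I, W y = c • U y + d • V y

lemma exists_isSpanningPair (hmu : 0 < mu) (hlam : 0 < lam) (hρ : ContDiff ℝ 1 ρ₀) {M : ℝ}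
    (hM : ∀ x, |ρ₀ x| ≤ M) (hO : IsOpen I) (hI : I.OrdConnected) (hvol : volume I = ⊤)
    (hU : IsSystemSolution g k mu lam ρ₀ I U) (hV : IsSystemSolution g k mu lam ρ₀ I V)
    (hdet : ∀ x ∈ I, U x 0 * V x 1 - U x 1 * V x 0 ≠ 0)
    (lU : ∀ j, MemLp (fun x => U x j) 2 (volume.restrict I))
    (lV : ∀ j, MemLp (fun x => V x j) 2 (volume.restrict I)) :
    ∃ n, IsSpanningPair g k mu lam ρ₀ I U V n := by
  have hn : ∀ x, ∃ n : Matrix (Fin 2) (Fin 2) ℝ, x ∈ I → ∀ w : Fin 4 → ℝ,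
      BoundaryRelation n w ↔ w ∈ Submodule.span ℝ {U x, V x} := fun x => by
    by_cases hx : x ∈ I
    · obtain ⟨n, hn⟩ := exists_boundaryRelation_iff (hdet x hx)
      exact ⟨n, fun _ => hn⟩
    · exact ⟨0, fun h => absurd h hx⟩
  choose n hn using hn
  have hne : I.Nonempty := by
    by_contra h
    rw [not_nonempty_iff_eq_empty] at h
    simp [h] at hvol
  obtain ⟨x, hx⟩ := hne
  exact ⟨n, hU, hV, lU, lV, hn, fun W hW lW => hU.exists_combination hO hI hvol hρ hmu.ne'
    hlam.ne' hM hV hW lU lV lW hx (hdet x hx)⟩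

lemma IsDecayingPairAtTop.exists_isSpanningPair (hk : 0 < k) (hmu : 0 < mu) (hlam : 0 < lam)
    (hρ : IsIncreasingProfile ρ₀ ρm ρp) (h : IsDecayingPairAtTop g k mu lam ρ₀ ρp a U V) :
    ∃ x₀ > a, ∃ n, IsSpanningPair g k mu lam ρ₀ (Ioi x₀) U V n := by
  obtain ⟨x₀, hx₀, hdet, lU, lV⟩ := h.exists_independent_memLp hk hmu hlam hρ.contDiff hρ.pos hρ.right_pos
  exact ⟨x₀, hx₀, RayleighTaylor.exists_isSpanningPair hmu hlam hρ.contDiff hρ.abs_le isOpen_Ioi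
    ordConnected_Ioi Real.volume_Ioi
    (fun x hx => h.solution₁.1 x (hx₀.lt.trans hx)) (fun x hx => h.solution₂.1 x (hx₀.lt.trans hx))
    (fun x hx => hdet x (le_of_lt hx)) lU lV⟩

lemma IsDecayingPairAtBot.exists_isSpanningPair (hk : 0 < k) (hmu : 0 < mu) (hlam : 0 < lam)
    (hρ : IsIncreasingProfile ρ₀ ρm ρp) (h : IsDecayingPairAtBot g k mu lam ρ₀ ρm a U V) :
    ∃ x₀ < a, ∃ n, IsSpanningPair g k mu lam ρ₀ (Iio x₀) U V n := by
  obtain ⟨x₀, hx₀, hdet, lU, lV⟩ := h.exists_independent_memLp hk hmu hlam hρ.contDiff hρ.pos hρ.left_pos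
  exact ⟨x₀, hx₀, RayleighTaylor.exists_isSpanningPair hmu hlam hρ.contDiff hρ.abs_le isOpen_Iio
    ordConnected_Iio Real.volume_Iio
    (fun x hx => h.solution₃.1 x (lt_trans hx hx₀)) (fun x hx => h.solution₄.1 x (lt_trans hx hx₀))
    (fun x hx => hdet x (le_of_lt hx)) lU lV⟩

end BoundaryMatrices

/-! ### Gluing solutions across the endpoints -/

section Gluing

variable {g k mu lam : ℝ} {ρ₀ : ℝ → ℝ} {I : Set ℝ}

lemma continuousAt_mulVec {A : ℝ → Matrix (Fin 4) (Fin 4) ℝ} {G : ℝ → Fin 4 → ℝ} {x : ℝ}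
    (hA : ContinuousAt A x) (hG : ContinuousAt G x) :
    ContinuousAt (fun y => (A y).mulVec (G y)) x := by
  have hm : Continuous fun p : Matrix (Fin 4) (Fin 4) ℝ × (Fin 4 → ℝ) => p.1.mulVec p.2 :=
    continuous_fst.matrix_mulVec continuous_snd
  exact hm.continuousAt.comp (hA.prodMk hG)

/-- Solutions on both sides of a point `c` with the same limit at `c` form a solution. -/
lemma IsSystemSolution.of_sides (hO : IsOpen I) (hρ : ContDiff ℝ 1 ρ₀) {c : ℝ}
    {G : ℝ → Fin 4 → ℝ} (hl : IsSystemSolution g k mu lam ρ₀ (I ∩ Iio c) G)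
    (hr : IsSystemSolution g k mu lam ρ₀ (I ∩ Ioi c) G) (hG : ContinuousAt G c) :
    IsSystemSolution g k mu lam ρ₀ I G := by
  intro x hx
  rcases lt_trichotomy x c with h | rfl | h
  · exact hl x ⟨hx, h⟩
  · have hA := (continuous_systemMatrix (g := g) (k := k) (mu := mu) (lam := lam) hρ).continuousAt
      (x := x)
    have hlim : Tendsto (fun y => (matL k mu lam ρ₀ y + deriv ρ₀ y • matR g k mu lam).mulVec (G y))
        (𝓝 x) (𝓝 ((matL k mu lam ρ₀ x + deriv ρ₀ x • matR g k mu lam).mulVec (G x))) :=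
      continuousAt_mulVec hA hG
    have hIr : I ∩ Ioi x ∈ 𝓝[>] x :=
      inter_mem (mem_nhdsWithin_of_mem_nhds (hO.mem_nhds hx)) self_mem_nhdsWithin
    have hIl : I ∩ Iio x ∈ 𝓝[<] x :=
      inter_mem (mem_nhdsWithin_of_mem_nhds (hO.mem_nhds hx)) self_mem_nhdsWithin
    -- The right-hand side of the system is continuous at the gluing point, so the derivatives from
    -- both sides have the same limit there, and that limit is the derivative of `G`.
    have A := hasDerivWithinAt_Ici_of_tendsto_deriv (s := I ∩ Ioi x)
      (fun y hy => (hr y hy).differentiableAt.differentiableWithinAt) hG.continuousWithinAt hIr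
      ((hlim.mono_left nhdsWithin_le_nhds).congr' (by
        filter_upwards [hIr] with y hy using (hr y hy).deriv.symm))
    have B := hasDerivWithinAt_Iic_of_tendsto_deriv (s := I ∩ Iio x)
      (fun y hy => (hl y hy).differentiableAt.differentiableWithinAt) hG.continuousWithinAt hIl
      ((hlim.mono_left nhdsWithin_le_nhds).congr' (by
        filter_upwards [hIl] with y hy using (hl y hy).deriv.symm))
    simpa using B.union A
  · exact hr x ⟨hx, h⟩

lemma IsSystemSolution.congr (hO : IsOpen I) {U V : ℝ → Fin 4 → ℝ}
    (hU : IsSystemSolution g k mu lam ρ₀ I U) (h : EqOn V U I) :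
    IsSystemSolution g k mu lam ρ₀ I V := by
  intro x hx
  rw [h hx]
  refine (hU x hx).congr_of_eventuallyEq ?_
  filter_upwards [hO.mem_nhds hx] with y hy using h hy

/-- A solution on `(xm, xp)` continues by solutions near `(-∞, xm]` and `[xp, ∞)` that take its
boundary values. -/
lemma IsSystemSolution.exists_extension (hρ : ContDiff ℝ 1 ρ₀) {xm xp : ℝ} (hlt : xm < xp)
    {L W R : ℝ → Fin 4 → ℝ} {bm bp : ℝ} (hbm : xm < bm) (hbp : bp < xp)
    (hL : IsSystemSolution g k mu lam ρ₀ (Iio bm) L)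
    (hW : IsSystemSolution g k mu lam ρ₀ (Ioo xm xp) W)
    (hR : IsSystemSolution g k mu lam ρ₀ (Ioi bp) R)
    (tL : Tendsto W (𝓝[Ioo xm xp] xm) (𝓝 (L xm))) (tR : Tendsto W (𝓝[Ioo xm xp] xp) (𝓝 (R xp))) :
    ∃ G : ℝ → Fin 4 → ℝ, IsSystemSolution g k mu lam ρ₀ univ G ∧ EqOn G L (Iio xm) ∧
      EqOn G W (Ioo xm xp) ∧ EqOn G R (Ioi xp) := by
  rw [nhdsWithin_Ioo_eq_nhdsGT hlt] at tL
  rw [nhdsWithin_Ioo_eq_nhdsLT hlt] at tR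
  let G : ℝ → Fin 4 → ℝ := fun x => if x ≤ xm then L x else if x < xp then W x else R x
  have eL : EqOn G L (Iic xm) := fun x hx => if_pos hx
  have eW : EqOn G W (Ioo xm xp) := fun x hx => by
    simp only [G]
    rw [if_neg (not_le.mpr hx.1), if_pos hx.2]
  have eR : EqOn G R (Ici xp) := fun x hx => by
    simp only [G]
    rw [if_neg (not_le.mpr (hlt.trans_le hx)), if_neg (not_lt.mpr hx)]
  have sL : IsSystemSolution g k mu lam ρ₀ (Iio xm) G :=
    (hL.mono (Iio_subset_Iio hbm.le)).congr isOpen_Iio (eL.mono Iio_subset_Iic_self)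
  have sR : IsSystemSolution g k mu lam ρ₀ (Ioi xp) G :=
    (hR.mono (Ioi_subset_Ioi hbp.le)).congr isOpen_Ioi (eR.mono Ioi_subset_Ici_self)
  have sW : IsSystemSolution g k mu lam ρ₀ (Ioo xm xp) G := hW.congr isOpen_Ioo eW
  have cL : ContinuousAt G xm := by
    rw [continuousAt_iff_continuous_left'_right']
    have e0 : G xm = L xm := eL self_mem_Iic
    constructor
    · refine ((hL xm hbm).continuousAt.continuousWithinAt (s := Iio xm)).congr
        (fun y hy => eL (Iio_subset_Iic_self hy)) e0
    · rw [ContinuousWithinAt, e0]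
      refine tL.congr' ?_
      filter_upwards [Ioo_mem_nhdsGT hlt] with y hy using (eW hy).symm
  have cR : ContinuousAt G xp := by
    rw [continuousAt_iff_continuous_left'_right']
    have e0 : G xp = R xp := eR self_mem_Ici
    constructor
    · rw [ContinuousWithinAt, e0]
      refine tR.congr' ?_
      filter_upwards [Ioo_mem_nhdsLT hlt] with y hy using (eW hy).symm
    · refine ((hR xp hbp).continuousAt.continuousWithinAt (s := Ioi xp)).congr
        (fun y hy => eR (Ioi_subset_Ici_self hy)) e0
  have s1 : IsSystemSolution g k mu lam ρ₀ (Ioi xm) G :=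
    IsSystemSolution.of_sides isOpen_Ioi hρ (sW.mono fun x hx => ⟨hx.1, hx.2⟩)
      (sR.mono inter_subset_right) cR
  exact ⟨G, IsSystemSolution.of_sides isOpen_univ hρ (sL.mono inter_subset_right)
    (s1.mono inter_subset_right) cL, eL.mono Iio_subset_Iic_self, eW, eR.mono Ioi_subset_Ici_self⟩

lemma memLp_of_pieces {f : ℝ → ℝ} (hf : Continuous f) {xm xp : ℝ}
    (hm : MemLp f 2 (volume.restrict (Iio xm))) (hp : MemLp f 2 (volume.restrict (Ioi xp))) :
    MemLp f 2 volume := by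
  rw [memLp_two_iff_integrable_sq hf.aestronglyMeasurable] at hm hp ⊢
  have h1 : IntegrableOn (fun x => f x ^ 2) (Iio xm) := hm
  have h2 : IntegrableOn (fun x => f x ^ 2) (Ioi xp) := hp
  have h3 : IntegrableOn (fun x => f x ^ 2) (Icc xm xp) :=
    (hf.pow 2).continuousOn.integrableOn_compact isCompact_Icc
  rw [← integrableOn_univ]
  refine ((h1.union h3).union h2).mono_set fun x _ => ?_
  rcases lt_or_ge x xm with h | h
  · exact Or.inl (Or.inl h)
  · rcases le_or_gt x xp with h' | h'
    · exact Or.inl (Or.inr ⟨h, h'⟩)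
    · exact Or.inr h'

end Gluing

/-! ### The correspondence between the line and the interval -/

section Correspondence

variable {g k mu lam ρm ρp : ℝ} {ρ₀ : ℝ → ℝ} {I : Set ℝ} {U V U₁ U₂ U₃ U₄ : ℝ → Fin 4 → ℝ}
  {n nm np : ℝ → Matrix (Fin 2) (Fin 2) ℝ} {xm xp bm bp : ℝ}

lemma exists_isDecayingPairs (g : ℝ) (hk : 0 < k) (hmu : 0 < mu) (hlam : 0 < lam)
    (hρ : IsIncreasingProfile ρ₀ ρm ρp) :
    ∃ xbm xbp : ℝ, xbm < xbp ∧ ∃ U₁ U₂ U₃ U₄ : ℝ → Fin 4 → ℝ,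
      IsDecayingPairAtTop g k mu lam ρ₀ ρp xbp U₁ U₂ ∧
      IsDecayingPairAtBot g k mu lam ρ₀ ρm xbm U₃ U₄ := by
  obtain ⟨a, ha, U₁, U₂, h⟩ := exists_isDecayingPairAtTop g hk hmu hlam hρ.contDiff hρ.left_pos
    hρ.left_le hρ.le_right hρ.right_pos hρ.tendsto_atTop hρ.integrableOn_deriv
  obtain ⟨b, hb, V₁, V₂, h'⟩ := exists_isDecayingPairAtTop (-g) hk hmu hlam
    (hρ.contDiff.comp contDiff_neg) hρ.left_pos (fun x => hρ.left_le (-x))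
    (fun x => hρ.le_right (-x)) hρ.left_pos (hρ.tendsto_atBot.comp tendsto_neg_atTop_atBot)
    hρ.integrableOn_deriv_neg
  refine ⟨-b, a, by linarith, U₁, U₂, reflect V₁, reflect V₂, h, ?_⟩
  simpa using h'.reflect

lemma IsSpanningPair.isFirstComponentOfCombination (h : IsSpanningPair g k mu lam ρ₀ I U V n)
    {W : ℝ → Fin 4 → ℝ} (hW : IsSystemSolution g k mu lam ρ₀ univ W)
    (lW : ∀ j, MemLp (fun x => W x j) 2 volume) {Φ : ℝ → ℝ} (he : Φ =ᵐ[volume] fun x => W x 0)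
    {J : Set ℝ} (hJ : MeasurableSet J) (hJI : J ⊆ I) :
    IsFirstComponentOfCombination J U V Φ := by
  obtain ⟨c, d, hcd⟩ := h.exists_combination W (hW.mono (subset_univ _))
    fun j => (lW j).restrict I
  refine ⟨c, d, ?_⟩
  filter_upwards [ae_restrict_of_ae he, ae_restrict_mem hJ] with x hx hxJ
  rw [hx, hcd x (hJI hxJ)]

lemma IsSpanningPair.boundaryRelation (h : IsSpanningPair g k mu lam ρ₀ I U V n)
    {W : ℝ → Fin 4 → ℝ} (hW : IsSystemSolution g k mu lam ρ₀ univ W)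
    (lW : ∀ j, MemLp (fun x => W x j) 2 volume) {x : ℝ} (hx : x ∈ I) :
    BoundaryRelation (n x) (W x) := by
  obtain ⟨c, d, hcd⟩ := h.exists_combination W (hW.mono (subset_univ _))
    fun j => (lW j).restrict I
  rw [h.boundaryRelation_iff x hx, Submodule.mem_span_pair]
  exact ⟨c, d, (hcd x hx).symm⟩

lemma IsH4Solution.exists_isSystemSolution_univ (hmu : 0 < mu) (hlam : 0 < lam)
    (hρ : ContDiff ℝ 1 ρ₀) {Φ : ℝ → ℝ} (h : IsH4Solution g k mu lam ρ₀ univ Φ) :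
    ∃ W : ℝ → Fin 4 → ℝ, IsSystemSolution g k mu lam ρ₀ univ W ∧
      (Φ =ᵐ[volume] fun x => W x 0) ∧ ∀ j, MemLp (fun x => W x j) 2 volume := by
  simpa using h.exists_isSystemSolution isOpen_univ ordConnected_univ univ_nonempty hρ hmu.ne'
    hlam.ne'

lemma isBVPSolution_of_line (hmu : 0 < mu) (hlam : 0 < lam) (hρ : IsIncreasingProfile ρ₀ ρm ρp)
    (hm : IsSpanningPair g k mu lam ρ₀ (Iio bm) U₃ U₄ nm)
    (hp : IsSpanningPair g k mu lam ρ₀ (Ioi bp) U₁ U₂ np) (hxm : xm < bm) (hxp : bp < xp)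
    {W : ℝ → Fin 4 → ℝ} (hW : IsSystemSolution g k mu lam ρ₀ univ W)
    (lW : ∀ j, MemLp (fun x => W x j) 2 volume) {Φ : ℝ → ℝ} (he : Φ =ᵐ[volume] fun x => W x 0) :
    IsBVPSolution g k mu lam ρ₀ xm xp (nm xm) (np xp) Φ := by
  obtain ⟨M', hM'⟩ := hρ.exists_abs_deriv_le
  have hW' := hW.mono (subset_univ (Ioo xm xp))
  have he' := ae_restrict_of_ae (s := Ioo xm xp) he
  have ht : ∀ x, HasTraces (Ioo xm xp) Φ x (W x) := fun x =>
    (hasTraces_iff isOpen_Ioo hρ.contDiff hW' he').mpr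
      ((hW x (mem_univ x)).continuousAt.tendsto.mono_left nhdsWithin_le_nhds)
  exact ⟨hW'.isH4Solution isOpen_Ioo hρ.contDiff hmu.ne' hlam.ne' hρ.abs_le hM' he'
    fun j => (lW j).restrict _, ⟨_, ht xm, hm.boundaryRelation hW lW hxm⟩,
    ⟨_, ht xp, hp.boundaryRelation hW lW hxp⟩⟩

/-- The boundary relations place the traces at both ends in the planes of the decaying solutions.
The resulting coefficients fix the two tails, which match `φ` in all four components and are square
integrable. -/
lemma IsBVPSolution.exists_isSystemSolution (hmu : 0 < mu) (hlam : 0 < lam)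
    (hρ : ContDiff ℝ 1 ρ₀)
    (hm : IsSpanningPair g k mu lam ρ₀ (Iio bm) U₃ U₄ nm)
    (hp : IsSpanningPair g k mu lam ρ₀ (Ioi bp) U₁ U₂ np) (hxm : xm < bm) (hxp : bp < xp)
    (hlt : xm < xp) {φ : ℝ → ℝ}
    (h : IsBVPSolution g k mu lam ρ₀ xm xp (nm xm) (np xp) φ) :
    ∃ G : ℝ → Fin 4 → ℝ, IsSystemSolution g k mu lam ρ₀ univ G ∧
      (∀ j, MemLp (fun x => G x j) 2 volume) ∧
      φ =ᵐ[volume.restrict (Ioo xm xp)] fun x => G x 0 := by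
  obtain ⟨h4, ⟨tm, hTm, hBm⟩, ⟨tp, hTp, hBp⟩⟩ := h
  obtain ⟨W, hW, he, lW⟩ := h4.exists_isSystemSolution isOpen_Ioo ordConnected_Ioo
    (nonempty_Ioo.mpr hlt) hρ hmu.ne' hlam.ne'
  rw [hasTraces_iff isOpen_Ioo hρ hW he] at hTm hTp
  rw [hm.boundaryRelation_iff xm hxm, Submodule.mem_span_pair] at hBm
  rw [hp.boundaryRelation_iff xp hxp, Submodule.mem_span_pair] at hBp
  obtain ⟨e, f, rfl⟩ := hBm
  obtain ⟨c, d, rfl⟩ := hBp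
  obtain ⟨G, hG, eL, eW, eR⟩ := IsSystemSolution.exists_extension hρ hlt hxm hxp
    (hm.left_solution.combination hm.right_solution e f) hW
    (hp.left_solution.combination hp.right_solution c d) hTm hTp
  refine ⟨G, hG, fun j => ?_, ?_⟩
  · refine memLp_of_pieces (continuousOn_univ.mp (hG.continuousOn_apply j)) (xm := xm)
      (xp := xp) ?_ ?_
    · have := ((hm.left_memLp j).const_mul e).add ((hm.right_memLp j).const_mul f)
      refine (this.mono_measure (Measure.restrict_mono_set _ (Iio_subset_Iio hxm.le))).ae_eq ?_
      filter_upwards [ae_restrict_mem measurableSet_Iio] with x hx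
      rw [eL hx]
      rfl
    · have := ((hp.left_memLp j).const_mul c).add ((hp.right_memLp j).const_mul d)
      refine (this.mono_measure (Measure.restrict_mono_set _ (Ioi_subset_Ioi hxp.le))).ae_eq ?_
      filter_upwards [ae_restrict_mem measurableSet_Ioi] with x hx
      rw [eR hx]
      rfl
  · filter_upwards [he, ae_restrict_mem measurableSet_Ioo] with x hx hxI
    rw [hx, eW hxI]

/-- Two solutions on the line that agree a.e. on an interval agree everywhere. -/
lemma IsSystemSolution.eq_of_ae_eq (hρ : ContDiff ℝ 1 ρ₀) (hlt : xm < xp)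
    (hU : IsSystemSolution g k mu lam ρ₀ univ U) (hV : IsSystemSolution g k mu lam ρ₀ univ V)
    (h : (fun x => U x 0) =ᵐ[volume.restrict (Ioo xm xp)] fun x => V x 0) : U = V := by
  have hU' := (hU.mono (subset_univ (Ioo xm xp)))
  have hV' := (hV.mono (subset_univ (Ioo xm xp)))
  obtain ⟨x, hx⟩ := nonempty_Ioo.mpr hlt
  -- Both `U x` and `V x` are traces at `x` of the same class on the interval, so they coincide by
  -- uniqueness of limits.
  have hx0 : U x = V x := by
    have tU := (hasTraces_iff (x := x) (t := U x) isOpen_Ioo hρ hU' (ae_eq_refl _)).mpr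
      (hU' x hx).continuousAt.continuousWithinAt
    have tV := (hasTraces_iff isOpen_Ioo hρ hV' h).mp tU
    have : (𝓝[Ioo xm xp] x).NeBot := by
      rw [isOpen_Ioo.nhdsWithin_eq hx]
      infer_instance
    exact tendsto_nhds_unique tV (hV' x hx).continuousAt.continuousWithinAt
  funext y
  exact hU.eqOn ordConnected_univ hρ hV (mem_univ x) hx0 (mem_univ y)

end Correspondence

end RayleighTaylor

end

theorem proposition4p1 (g k mu lam ρm ρp : ℝ) (ρ₀ : ℝ → ℝ)
    (hg : 0 < g) (hk : 0 < k) (hmu : 0 < mu) (hlam : 0 < lam)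
    (hρ : RayleighTaylor.IsIncreasingProfile ρ₀ ρm ρp) :
    -- decaying pairs of solutions exist near both infinities
    (∃ xbm xbp : ℝ, xbm < xbp ∧ ∃ U₁ U₂ U₃ U₄ : ℝ → Fin 4 → ℝ,
      RayleighTaylor.IsDecayingPairAtTop g k mu lam ρ₀ ρp xbp U₁ U₂ ∧
      RayleighTaylor.IsDecayingPairAtBot g k mu lam ρ₀ ρm xbm U₃ U₄) ∧
    -- and for any of them
    ∀ (xbm xbp : ℝ) (U₁ U₂ U₃ U₄ : ℝ → Fin 4 → ℝ), xbm < xbp →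
      RayleighTaylor.IsDecayingPairAtTop g k mu lam ρ₀ ρp xbp U₁ U₂ →
      RayleighTaylor.IsDecayingPairAtBot g k mu lam ρ₀ ρm xbm U₃ U₄ →
      ∃ xm₀ ≤ xbm, ∃ xp₀ ≥ xbp, ∃ nm np : ℝ → Matrix (Fin 2) (Fin 2) ℝ,
        -- the boundary relations cut out the values of the decaying solutions
        (∀ xm ≤ xm₀, ∀ w : Fin 4 → ℝ, RayleighTaylor.BoundaryRelation (nm xm) w ↔
          w ∈ Submodule.span ℝ {U₃ xm, U₄ xm}) ∧
        (∀ xp ≥ xp₀, ∀ w : Fin 4 → ℝ, RayleighTaylor.BoundaryRelation (np xp) w ↔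
          w ∈ Submodule.span ℝ {U₁ xp, U₂ xp}) ∧
        ∀ xm ≤ xm₀, ∀ xp ≥ xp₀,
          -- from the line to the interval
          (∀ Φ : ℝ → ℝ, RayleighTaylor.IsH4Solution g k mu lam ρ₀ Set.univ Φ →
            RayleighTaylor.IsBVPSolution g k mu lam ρ₀ xm xp (nm xm) (np xp) Φ ∧
            RayleighTaylor.IsFirstComponentOfCombination (Set.Ioi xp) U₁ U₂ Φ ∧
            RayleighTaylor.IsFirstComponentOfCombination (Set.Iio xm) U₃ U₄ Φ) ∧
          -- from the interval to the line
          (∀ φ : ℝ → ℝ, RayleighTaylor.IsBVPSolution g k mu lam ρ₀ xm xp (nm xm) (np xp) φ →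
            ∃ Φ : ℝ → ℝ, RayleighTaylor.IsH4Solution g k mu lam ρ₀ Set.univ Φ ∧
              (∀ᵐ x ∂(MeasureTheory.volume.restrict (Set.Ioo xm xp)), Φ x = φ x) ∧
              RayleighTaylor.IsFirstComponentOfCombination (Set.Ioi xp) U₁ U₂ Φ ∧
              RayleighTaylor.IsFirstComponentOfCombination (Set.Iio xm) U₃ U₄ Φ ∧
              ∀ Ψ : ℝ → ℝ, RayleighTaylor.IsH4Solution g k mu lam ρ₀ Set.univ Ψ →
                (∀ᵐ x ∂(MeasureTheory.volume.restrict (Set.Ioo xm xp)), Ψ x = φ x) →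
                ∀ᵐ x, Ψ x = Φ x) := by
  refine ⟨RayleighTaylor.exists_isDecayingPairs g hk hmu hlam hρ, ?_⟩
  intro xbm xbp U₁ U₂ U₃ U₄ hlt hTop hBot
  obtain ⟨bp, hbp, np, hp⟩ := hTop.exists_isSpanningPair hk hmu hlam hρ
  obtain ⟨bm, hbm, nm, hm⟩ := hBot.exists_isSpanningPair hk hmu hlam hρ
  obtain ⟨M', hM'⟩ := hρ.exists_abs_deriv_le
  -- The spanning property holds on the open half lines ending at `bm` and `bp`; moving by 1 puts
  -- every admissible endpoint strictly inside them.
  refine ⟨bm - 1, by linarith, bp + 1, by linarith, nm, np,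
    fun xm hxm => hm.boundaryRelation_iff xm (Set.mem_Iio.mpr (by linarith)),
    fun xp hxp => hp.boundaryRelation_iff xp (Set.mem_Ioi.mpr (by linarith)), ?_⟩
  intro xm hxm xp hxp
  have hxm' : xm < bm := by linarith
  have hxp' : bp < xp := by linarith
  have hlt' : xm < xp := by linarith
  have sm : Set.Iio xm ⊆ Set.Iio bm := Set.Iio_subset_Iio hxm'.le
  have sp : Set.Ioi xp ⊆ Set.Ioi bp := Set.Ioi_subset_Ioi hxp'.le
  refine ⟨fun Φ hΦ => ?_, fun φ hφ => ?_⟩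
  · obtain ⟨W, hW, he, lW⟩ := hΦ.exists_isSystemSolution_univ hmu hlam hρ.contDiff
    exact ⟨RayleighTaylor.isBVPSolution_of_line hmu hlam hρ hm hp hxm' hxp' hW lW he,
      hp.isFirstComponentOfCombination hW lW he measurableSet_Ioi sp,
      hm.isFirstComponentOfCombination hW lW he measurableSet_Iio sm⟩
  · obtain ⟨G, hG, lG, he⟩ :=
      hφ.exists_isSystemSolution hmu hlam hρ.contDiff hm hp hxm' hxp' hlt'
    refine ⟨fun x => G x 0, ?_, ?_, ?_, ?_, ?_⟩
    · exact hG.isH4Solution isOpen_univ hρ.contDiff hmu.ne' hlam.ne' hρ.abs_le hM'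
        (MeasureTheory.ae_eq_refl _) fun j => (lG j).restrict _
    · exact he.symm
    · exact hp.isFirstComponentOfCombination hG lG (MeasureTheory.ae_eq_refl _) measurableSet_Ioi sp
    · exact hm.isFirstComponentOfCombination hG lG (MeasureTheory.ae_eq_refl _) measurableSet_Iio sm
    · intro Ψ hΨ hΨφ
      -- Any competitor has a system representative that agrees with `G` on the interval, hence
      -- everywhere.
      obtain ⟨W, hW, heW, -⟩ := hΨ.exists_isSystemSolution_univ hmu hlam hρ.contDiff
      have : W = G := hW.eq_of_ae_eq hρ.contDiff hlt' hG
        (by filter_upwards [MeasureTheory.ae_restrict_of_ae heW, hΨφ, he] with x h1 h2 h3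
            rw [← h1, h2, h3])
      rw [← this]
      exact heW
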